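/- Let $\Sigma=\{0,1\}$ and encode a pair of strings $x,y\in\Sigma^*$ as the string $\langle x,y\rangle = x_1x_1x_2x_2\cdots x_{|x|}x_{|x|}\,01\,y_1y_1y_2y_2\cdots y_{|y|}y_{|y|}\in\Sigma^*$. Let $\mathrm{PEq}$ (respectively $\mathrm{NPEq}$) be the class of equivalence relations $R$ on $\Sigma^*$ whose induced language $\{\langle x,y\rangle : (x,y)\in R\}$ is in $\mathrm{P}$ (respectively $\mathrm{NP}$). For equivalence relations $R,S$ on $\Sigma^*$, say that $R$ polynomial-time kernel reduces to $S$ if there is a polynomial-time computable function $f\colon\Sigma^*\to\Sigma^*$ such that for all $x,y\in\Sigma^*$ we have $(x,y)\in R$ if and only if $(f(x),f(y))\in S$. An equivalence relation $S$ is $\mathrm{NPEq}$-complete if $S\in\mathrm{NPEq}$ and every $R\in\mathrm{NPEq}$ polynomial-time kernel reduces to $S$. Theorem. If $\mathrm{PEq}\neq\mathrm{NPEq}$, then there is an equivalence relation in $\mathrm{NPEq}$ that is neither in $\mathrm{PEq}$ nor $\mathrm{NPEq}$-complete. -/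

import Mathlib

namespace KernelReduction

open Turing

/-- Binary strings. -/
abbrev Str : Type := List Bool

/-- Every symbol of a string, written twice. -/
def double (x : Str) : Str := x.flatMap fun b => [b, b]

/-- The pairwise encoding `x₁x₁x₂x₂⋯01y₁y₁y₂y₂⋯` of two binary strings. -/
def pair (x y : Str) : Str := double x ++ [false, true] ++ double y

/-- The language induced by an equivalence relation on binary strings. -/
def langOf (R : Setoid Str) : Language Bool := {w | ∃ x y : Str, R x y ∧ w = pair x y}

/-- A nondeterministic Turing machine over the binary input alphabet. It consists of one of
Mathlib's finite multi-stack Turing machines, a second program `alt` for it (in every step the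
machine follows either `tm.m` or `alt`, at its choice) and a set of accepting internal states.
The output stack `tm.k₁` plays no special role. -/
structure NTM where
  /-- the underlying machine, with the first of the two programs -/
  tm : FinTM2
  /-- the second program -/
  alt : tm.Λ → TM2.Stmt tm.Γ tm.Λ tm.σ
  /-- the input alphabet is `{0, 1}` -/
  inputAlphabet : tm.Γ tm.k₀ ≃ Bool
  /-- the accepting internal states -/
  accept : Set tm.σ

namespace NTM

variable (N : NTM)

/-- The machine is deterministic if it never has a choice: its two programs are the same. -/
def Deterministic : Prop := N.alt = N.tm.m

/-- The initial configuration on input `w`. -/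
def init (w : Str) : N.tm.Cfg := initList N.tm (w.map N.inputAlphabet.symm)

/-- One step of the machine. There is no step from a configuration that has halted. -/
def Step (c c' : N.tm.Cfg) : Prop :=
  TM2.step N.tm.m c = some c' ∨ TM2.step N.alt c = some c'

/-- `N.Steps n c c'`: some computation path leads from `c` to `c'` in exactly `n` steps. -/
inductive Steps : ℕ → N.tm.Cfg → N.tm.Cfg → Prop
  | refl (c : N.tm.Cfg) : Steps 0 c c
  | tail {n : ℕ} {c c' c'' : N.tm.Cfg} : Steps n c c' → N.Step c' c'' → Steps (n + 1) c c''

/-- Some computation path on input `w` halts in an accepting state. -/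
def Accepts (w : Str) : Prop :=
  ∃ (n : ℕ) (c : N.tm.Cfg), N.Steps n (N.init w) c ∧ c.l = none ∧ c.var ∈ N.accept

/-- On input `w`, every computation path halts after at most `t` steps. -/
def HaltsWithin (w : Str) (t : ℕ) : Prop :=
  ∀ (n : ℕ) (c : N.tm.Cfg), N.Steps n (N.init w) c → n ≤ t

/-- The machine decides the language `L` in polynomial time. -/
def DecidesInPolyTime (L : Language Bool) : Prop :=
  (∃ p : Polynomial ℕ, ∀ w : Str, N.HaltsWithin w (p.eval w.length)) ∧
    ∀ w : Str, w ∈ L ↔ N.Accepts w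

end NTM

/-- The class **P**. -/
def classP : Set (Language Bool) := {L | ∃ M : NTM, M.Deterministic ∧ M.DecidesInPolyTime L}

/-- The class **NP**. -/
def classNP : Set (Language Bool) := {L | ∃ N : NTM, N.DecidesInPolyTime L}

/-- The class **FP** of polynomial-time computable functions on binary strings. -/
def classFP : Set (Str → Str) := {f | Nonempty (TM2ComputableInPolyTime id id f)}

/-- The equivalence relations whose induced language lies in the complexity class `C`. -/
def eqClass (C : Set (Language Bool)) : Set (Setoid Str) := {R | langOf R ∈ C}

/-- The class **PEq**. -/
def PEq : Set (Setoid Str) := eqClass classP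

/-- The class **NPEq**. -/
def NPEq : Set (Setoid Str) := eqClass classNP

/-- `R` polynomial-time kernel reduces to `S`. -/
def PolyKernelReduces (R S : Setoid Str) : Prop :=
  ∃ f ∈ classFP, ∀ x y : Str, R x y ↔ S (f x) (f y)

/-- `S` is hard, under polynomial-time kernel reductions, for the class `D` of equivalence
relations. -/
def IsHard (D : Set (Setoid Str)) (S : Setoid Str) : Prop :=
  ∀ R ∈ D, PolyKernelReduces R S

/-- `S` is complete, under polynomial-time kernel reductions, in the class `D` of equivalence
relations. -/
def IsComplete (D : Set (Setoid Str)) (S : Setoid Str) : Prop :=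
  S ∈ D ∧ IsHard D S

end KernelReduction

/-! Lengths are split into huge alternating gaps. Let `S` lie in NPEq but not in PEq. `logParity` is
constant on each interval from `tower i` to `tower (i + 1)` and alternates with `i`
(`logParity_eq`). For a bit `b` let `C b` consist of `langOf S` and of all strings whose length has
`logParity` equal to `b`; the candidates are `collapse (C true)` and `collapse (C false)`.

Both are in NPEq, as `C b` is in NP (`collapse_mem_NPEq`). If both were in PEq, comparing with a
fixed member of the big class would put `C true` and `C false` in P
(`mem_classP_of_collapse_mem_PEq`). Their intersection is `langOf S`, which would then be in P. So
one of them is outside PEq.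

Neither is NPEq-hard, whatever `S` is: even equality, which is in PEq, does not reduce to `collapse
(C b)`. Such a reduction `f` has polynomially bounded output length (`exists_polynomial_length_le`).
With `m = tower i` for large `i` of the right parity, it sends strings of length `m + 1` to strings
shorter than `2 ^ m = tower (i + 1)`. Images of length at least `m` all fall in the one big class,
and fewer than `2 ^ m` strings are shorter than `m`, so `2 ^ (m + 1)` inputs cannot stay
inequivalent (`not_polyKernelReduces_collapse`).

On the machine side, all closure properties of P and NP come from one construction, `combine`: split
the input with a finite transducer, run two machines in sequence, and take the conjunction or
disjunction of the answers. Only equality and `logParity` need machines written by hand. -/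

namespace KernelReduction

open Turing

/-! ### Computation paths: halting times, acceptance and simulation -/

namespace NTM

/-- The first (`false`) or the second (`true`) program of a machine. -/
def prog (N : NTM) (b : Bool) : N.tm.Λ → TM2.Stmt N.tm.Γ N.tm.Λ N.tm.σ :=
  cond b N.alt N.tm.m

/-- Every computation path from `c` halts after at most `t` steps. -/
def Halts (N : NTM) (t : ℕ) (c : N.tm.Cfg) : Prop :=
  ∀ (n : ℕ) (c' : N.tm.Cfg), N.Steps n c c' → n ≤ t

/-- `d` is a halting configuration that is reachable from `c`. -/
def Final (N : NTM) (c d : N.tm.Cfg) : Prop :=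
  (∃ n, N.Steps n c d) ∧ d.l = none

/-- Some computation path from `c` halts in an accepting state. -/
def Acc (N : NTM) (c : N.tm.Cfg) : Prop :=
  ∃ d, N.Final c d ∧ d.var ∈ N.accept

variable {N : NTM}

theorem step_iff {c c' : N.tm.Cfg} : N.Step c c' ↔ ∃ b, TM2.step (N.prog b) c = some c' := by
  simp [Step, prog]

theorem not_step_of_halted {c c' : N.tm.Cfg} (h : c.l = none) : ¬ N.Step c c' := by
  obtain ⟨l, v, S⟩ := c
  obtain rfl : l = none := h
  simp [Step]

theorem Steps.head {n : ℕ} {c c' c'' : N.tm.Cfg} (h : N.Step c c') (h' : N.Steps n c' c'') :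
    N.Steps (n + 1) c c'' := by
  induction h' with
  | refl => exact .tail (.refl _) h
  | tail _ h₂ ih => exact .tail (ih h) h₂

theorem Steps.cases_head {n : ℕ} {c c'' : N.tm.Cfg} (h : N.Steps n c c'') :
    (n = 0 ∧ c = c'') ∨ ∃ m c', n = m + 1 ∧ N.Step c c' ∧ N.Steps m c' c'' := by
  induction h with
  | refl => exact .inl ⟨rfl, rfl⟩
  | tail h₁ h₂ ih =>
    right
    rcases ih with ⟨rfl, rfl⟩ | ⟨m, c', rfl, h₃, h₄⟩
    · exact ⟨0, _, rfl, h₂, .refl _⟩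
    · exact ⟨m + 1, c', rfl, h₃, .tail h₄ h₂⟩

theorem final_self {c : N.tm.Cfg} (h : c.l = none) : N.Final c c := ⟨⟨0, .refl c⟩, h⟩

theorem final_of_halted {c d : N.tm.Cfg} (h : c.l = none) (hd : N.Final c d) : d = c := by
  obtain ⟨⟨n, hn⟩, -⟩ := hd
  rcases hn.cases_head with ⟨-, rfl⟩ | ⟨_, _, -, h', -⟩
  · rfl
  · exact absurd h' (not_step_of_halted h)

theorem final_iff_of_running {c d : N.tm.Cfg} (h : c.l ≠ none) :
    N.Final c d ↔ ∃ c', N.Step c c' ∧ N.Final c' d := by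
  constructor
  · rintro ⟨⟨n, hn⟩, hd⟩
    rcases hn.cases_head with ⟨-, rfl⟩ | ⟨m, c', -, h₁, h₂⟩
    · exact absurd hd h
    · exact ⟨c', h₁, ⟨m, h₂⟩, hd⟩
  · rintro ⟨c', h₁, ⟨n, hn⟩, hd⟩
    exact ⟨⟨n + 1, .head h₁ hn⟩, hd⟩

theorem acc_iff_of_halted {c : N.tm.Cfg} (h : c.l = none) : N.Acc c ↔ c.var ∈ N.accept := by
  constructor
  · rintro ⟨d, hd, ha⟩
    rwa [← final_of_halted h hd]
  · exact fun ha => ⟨c, final_self h, ha⟩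

theorem acc_iff_of_running {c : N.tm.Cfg} (h : c.l ≠ none) :
    N.Acc c ↔ ∃ c', N.Step c c' ∧ N.Acc c' := by
  simp only [Acc, final_iff_of_running h]
  constructor
  · rintro ⟨d, ⟨c', h₁, h₂⟩, ha⟩
    exact ⟨c', h₁, d, h₂, ha⟩
  · rintro ⟨c', h₁, d, h₂, ha⟩
    exact ⟨d, ⟨c', h₁, h₂⟩, ha⟩

theorem accepts_iff_acc {w : Str} : N.Accepts w ↔ N.Acc (N.init w) := by
  constructor
  · rintro ⟨n, c, h, hl, ha⟩
    exact ⟨c, ⟨⟨n, h⟩, hl⟩, ha⟩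
  · rintro ⟨c, ⟨⟨n, h⟩, hl⟩, ha⟩
    exact ⟨n, c, h, hl, ha⟩

theorem Halts.mono {s t : ℕ} {c : N.tm.Cfg} (h : N.Halts s c) (hst : s ≤ t) : N.Halts t c :=
  fun n c' hn => (h n c' hn).trans hst

theorem halts_of_halted {c : N.tm.Cfg} (h : c.l = none) : N.Halts 0 c := by
  intro n c' hn
  rcases hn.cases_head with ⟨rfl, -⟩ | ⟨_, _, -, h', -⟩
  · rfl
  · exact absurd h' (not_step_of_halted h)

theorem halts_succ_iff {t : ℕ} {c : N.tm.Cfg} :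
    N.Halts (t + 1) c ↔ ∀ c', N.Step c c' → N.Halts t c' := by
  constructor
  · intro h c' hc n d hn
    have := h _ _ (hn.head hc)
    omega
  · intro h n d hn
    rcases hn.cases_head with ⟨rfl, -⟩ | ⟨m, c', rfl, h₁, h₂⟩
    · exact Nat.zero_le _
    · exact Nat.succ_le_succ (h c' h₁ m d h₂)

theorem exists_step {c : N.tm.Cfg} (h : c.l ≠ none) : ∃ c', N.Step c c' := by
  obtain ⟨l, v, S⟩ := c
  cases l with
  | none => exact absurd rfl h
  | some l => exact ⟨_, .inl (TM2.step.eq_2 _ _ _ _)⟩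

theorem halted_of_halts_zero {c : N.tm.Cfg} (h : N.Halts 0 c) : c.l = none := by
  by_contra hl
  obtain ⟨c', hc⟩ := exists_step hl
  exact absurd (h _ _ (.tail (.refl c) hc)) (by omega)

theorem exists_final {t : ℕ} {c : N.tm.Cfg} (h : N.Halts t c) : ∃ d, N.Final c d := by
  induction t generalizing c with
  | zero => exact ⟨c, final_self (halted_of_halts_zero h)⟩
  | succ t ih =>
    by_cases hl : c.l = none
    · exact ⟨c, final_self hl⟩
    · obtain ⟨c', hc⟩ := exists_step hl
      obtain ⟨d, hd⟩ := ih (halts_succ_iff.1 h c' hc)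
      exact ⟨d, (final_iff_of_running hl).2 ⟨c', hc, hd⟩⟩

/-- The computation from `c` continues as the one from `c'`, with a delay of at most `n` steps. -/
def Leads (N : NTM) (n : ℕ) (c c' : N.tm.Cfg) : Prop :=
  (∀ t, N.Halts t c' → N.Halts (t + n) c) ∧ (N.Acc c ↔ N.Acc c')

theorem Leads.trans {m n : ℕ} {c c' c'' : N.tm.Cfg} (h : N.Leads m c c') (h' : N.Leads n c' c'') :
    N.Leads (m + n) c c'' :=
  ⟨fun t ht => (h.1 _ (h'.1 t ht)).mono (by omega), h.2.trans h'.2⟩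

theorem Leads.mono {m n : ℕ} {c c' : N.tm.Cfg} (h : N.Leads m c c') (hmn : m ≤ n) :
    N.Leads n c c' :=
  ⟨fun t ht => (h.1 t ht).mono (by omega), h.2⟩

/-- Both programs give the same successor, so this step involves no choice, even in a
nondeterministic machine. -/
theorem Leads.of_step {c c' : N.tm.Cfg} (h : ∀ b, TM2.step (N.prog b) c = some c') :
    N.Leads 1 c c' := by
  have hs : ∀ d, N.Step c d ↔ d = c' := by
    intro d
    rw [step_iff]
    exact ⟨fun ⟨b, hb⟩ => (Option.some.inj ((h b).symm.trans hb)).symm, fun hd => ⟨false, hd ▸ h _⟩⟩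
  have hl : c.l ≠ none := fun hl => not_step_of_halted hl ((hs c').2 rfl)
  refine ⟨fun t ht => halts_succ_iff.2 ?_, ?_⟩
  · intro d hd
    rwa [(hs d).1 hd]
  · simp [acc_iff_of_running hl, hs]

/-- A simulation of `M` by `N`, up to the moment when `M` halts. -/
theorem halts_and_acc_of_simulation {M : NTM} (e : M.tm.Cfg → N.tm.Cfg)
    (he : ∀ l v S b, TM2.step (N.prog b) (e ⟨some l, v, S⟩) =
      some (e (TM2.stepAux (M.prog b l) v S))) {t : ℕ} {c : M.tm.Cfg} (hc : M.Halts t c) :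
    (∀ T, (∀ d, M.Final c d → N.Halts T (e d)) → N.Halts (T + t) (e c)) ∧
      (N.Acc (e c) ↔ ∃ d, M.Final c d ∧ N.Acc (e d)) := by
  -- `e c` may still be running when `c` has halted; that remaining computation is what `T` and
  -- `N.Acc (e d)` account for.
  have halted : ∀ c : M.tm.Cfg, c.l = none → ∀ t,
      (∀ T, (∀ d, M.Final c d → N.Halts T (e d)) → N.Halts (T + t) (e c)) ∧
      (N.Acc (e c) ↔ ∃ d, M.Final c d ∧ N.Acc (e d)) := by
    intro c hl t
    refine ⟨fun T hT => (hT c (final_self hl)).mono (by omega), fun h => ⟨c, final_self hl, h⟩, ?_⟩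
    rintro ⟨d, hd, h⟩
    rwa [← final_of_halted hl hd]
  induction t generalizing c with
  | zero => exact halted c (halted_of_halts_zero hc) 0
  | succ t ih =>
    by_cases hl : c.l = none
    · exact halted c hl _
    -- The successors match exactly, choice by choice: `N` gains no paths and loses none.
    have hstep : ∀ d, N.Step (e c) d ↔ ∃ c', M.Step c c' ∧ d = e c' := by
      intro d
      obtain ⟨l, v, S⟩ := c
      cases l with
      | none => exact absurd rfl hl
      | some l =>
        constructor
        · intro h
          obtain ⟨b, hb⟩ := step_iff.1 h
          exact ⟨_, step_iff.2 ⟨b, TM2.step.eq_2 _ _ _ _⟩,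
            (Option.some.inj ((he l v S b).symm.trans hb)).symm⟩
        · rintro ⟨_, h, rfl⟩
          obtain ⟨b, hb⟩ := step_iff.1 h
          obtain rfl := Option.some.inj ((TM2.step.eq_2 _ _ _ _).symm.trans hb)
          exact step_iff.2 ⟨b, he l v S b⟩
    have hrun : (e c).l ≠ none := by
      obtain ⟨c', hc'⟩ := exists_step hl
      exact fun h => not_step_of_halted h ((hstep _).2 ⟨c', hc', rfl⟩)
    constructor
    · intro T hT
      refine halts_succ_iff.2 fun d hd => ?_
      obtain ⟨c', hc', rfl⟩ := (hstep d).1 hd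
      exact (ih (halts_succ_iff.1 hc c' hc')).1 T fun d hd =>
        hT d ((final_iff_of_running hl).2 ⟨c', hc', hd⟩)
    · rw [acc_iff_of_running hrun]
      constructor
      · rintro ⟨_, hd, ha⟩
        obtain ⟨c', hc', rfl⟩ := (hstep _).1 hd
        obtain ⟨d, hd, hda⟩ := (ih (halts_succ_iff.1 hc c' hc')).2.1 ha
        exact ⟨d, (final_iff_of_running hl).2 ⟨c', hc', hd⟩, hda⟩
      · rintro ⟨d, hd, hda⟩
        obtain ⟨c', hc', hd⟩ := (final_iff_of_running hl).1 hd
        exact ⟨e c', (hstep _).2 ⟨c', hc', rfl⟩, (ih (halts_succ_iff.1 hc c' hc')).2.2 ⟨d, hd, hda⟩⟩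

theorem init_eq (w : Str) : N.init w = ⟨some N.tm.main, N.tm.initialState,
    Function.update (fun _ => []) N.tm.k₀ (w.map N.inputAlphabet.symm)⟩ := by
  unfold init initList
  congr 1
  funext k
  by_cases h : k = N.tm.k₀
  · subst h
    simp
  · simp [h]

end NTM

/-! ### Finite transducers with two outputs -/

/-- A finite transducer that splits its input into two output strings, or rejects it. -/
structure Splitter where
  /-- the states -/
  Q : Type
  /-- there are finitely many states -/
  [fin : Fintype Q]
  /-- the initial state -/
  start : Q
  /-- the next state -/
  next : Q → Bool → Q
  /-- what is appended to the first output in a transition -/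
  out₁ : Q → Bool → Str
  /-- what is appended to the second output in a transition -/
  out₂ : Q → Bool → Str
  /-- the ends of the two outputs, or the rejection of the input -/
  final : Q → Option (Str × Str)
  /-- a bound for the lengths of all the pieces of the output -/
  size : ℕ
  length_out₁ : ∀ q b, (out₁ q b).length ≤ size
  length_out₂ : ∀ q b, (out₂ q b).length ≤ size
  length_final : ∀ q u v, final q = some (u, v) → u.length ≤ size ∧ v.length ≤ size

namespace Splitter

variable (T : Splitter)

instance : Fintype T.Q := T.fin

/-- The result for an input that starts in the state `q`. -/
def runFrom : T.Q → Str → Option (Str × Str)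
  | q, [] => T.final q
  | q, b :: w => (runFrom (T.next q b) w).map fun p => (T.out₁ q b ++ p.1, T.out₂ q b ++ p.2)

/-- The result for an input. -/
def run (w : Str) : Option (Str × Str) := T.runFrom T.start w

theorem length_runFrom {q : T.Q} {w u v : Str} (h : T.runFrom q w = some (u, v)) :
    u.length ≤ T.size * (w.length + 1) ∧ v.length ≤ T.size * (w.length + 1) := by
  induction w generalizing q u v with
  | nil => simpa using T.length_final q u v h
  | cons b w ih =>
    simp only [runFrom, Option.map_eq_some_iff, Prod.mk.injEq] at h
    obtain ⟨⟨u', v'⟩, h, rfl, rfl⟩ := h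
    have := ih h
    have h₁ := T.length_out₁ q b
    have h₂ := T.length_out₂ q b
    simp only [List.length_append, List.length_cons]
    constructor <;> nlinarith

end Splitter

/-! ### Running two machines on the outputs of a transducer -/

namespace Combine

/-- The stacks of a combination of two machines. -/
inductive Stack (K₁ K₂ : Type)
  | inp | tmp₁ | tmp₂ | left (k : K₁) | right (k : K₂)
  deriving DecidableEq, Fintype

/-- The labels of a combination of two machines. -/
inductive Label (Q Λ₁ Λ₂ : Type)
  | read (q : Q) | move₁ | move₂ | left (l : Λ₁) | between | right (l : Λ₂) | finish
  deriving Fintype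

/-- The internal states of a combination of two machines. -/
abbrev State (σ₁ σ₂ : Type) : Type := σ₁ × σ₂ × Option Bool

/-- The alphabets of a combination of two machines. -/
abbrev Alphabet {K₁ K₂ : Type} (Γ₁ : K₁ → Type) (Γ₂ : K₂ → Type) : Stack K₁ K₂ → Type
  | .left k => Γ₁ k
  | .right k => Γ₂ k
  | _ => Bool

section Stmt

variable {K₁ K₂ Q Λ₁ Λ₂ σ₁ σ₂ : Type} {Γ₁ : K₁ → Type} {Γ₂ : K₂ → Type}

/-- A statement of the first machine, as one of the combination. -/
def liftLeft : TM2.Stmt Γ₁ Λ₁ σ₁ →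
    TM2.Stmt (Alphabet Γ₁ Γ₂) (Label Q Λ₁ Λ₂) (State σ₁ σ₂)
  | .push k f q => .push (.left k) (fun s => f s.1) (liftLeft q)
  | .peek k f q => .peek (.left k) (fun s a => (f s.1 a, s.2)) (liftLeft q)
  | .pop k f q => .pop (.left k) (fun s a => (f s.1 a, s.2)) (liftLeft q)
  | .load f q => .load (fun s => (f s.1, s.2)) (liftLeft q)
  | .branch f q₁ q₂ => .branch (fun s => f s.1) (liftLeft q₁) (liftLeft q₂)
  | .goto f => .goto fun s => .left (f s.1)
  | .halt => .goto fun _ => .between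

/-- A statement of the second machine, as one of the combination. -/
def liftRight : TM2.Stmt Γ₂ Λ₂ σ₂ →
    TM2.Stmt (Alphabet Γ₁ Γ₂) (Label Q Λ₁ Λ₂) (State σ₁ σ₂)
  | .push k f q => .push (.right k) (fun s => f s.2.1) (liftRight q)
  | .peek k f q => .peek (.right k) (fun s a => (s.1, f s.2.1 a, s.2.2)) (liftRight q)
  | .pop k f q => .pop (.right k) (fun s a => (s.1, f s.2.1 a, s.2.2)) (liftRight q)
  | .load f q => .load (fun s => (s.1, f s.2.1, s.2.2)) (liftRight q)
  | .branch f q₁ q₂ => .branch (fun s => f s.2.1) (liftRight q₁) (liftRight q₂)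
  | .goto f => .goto fun s => .right (f s.2.1)
  | .halt => .goto fun _ => .finish

/-- Push `u` and then `v` on the two auxiliary stacks. -/
def pushAll (u v : Str) (q : TM2.Stmt (Alphabet Γ₁ Γ₂) (Label Q Λ₁ Λ₂) (State σ₁ σ₂)) :
    TM2.Stmt (Alphabet Γ₁ Γ₂) (Label Q Λ₁ Λ₂) (State σ₁ σ₂) :=
  u.foldr (fun b => .push .tmp₁ fun _ => b) (v.foldr (fun b => .push .tmp₂ fun _ => b) q)

/-- The stacks of a combination, given the stacks of the two machines. -/
def joinStk (w u v : Str) (S₁ : ∀ k, List (Γ₁ k)) (S₂ : ∀ k, List (Γ₂ k)) :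
    ∀ k : Stack K₁ K₂, List (Alphabet Γ₁ Γ₂ k)
  | .inp => w
  | .tmp₁ => u
  | .tmp₂ => v
  | .left k => S₁ k
  | .right k => S₂ k

variable [DecidableEq K₁] [DecidableEq K₂] (w u v x : Str)
  (S₁ : ∀ k, List (Γ₁ k)) (S₂ : ∀ k, List (Γ₂ k))

@[simp] theorem update_inp :
    Function.update (joinStk w u v S₁ S₂) .inp x = joinStk x u v S₁ S₂ := by
  funext k; cases k <;> rfl

@[simp] theorem update_tmp₁ :
    Function.update (joinStk w u v S₁ S₂) .tmp₁ x = joinStk w x v S₁ S₂ := by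
  funext k; cases k <;> rfl

@[simp] theorem update_tmp₂ :
    Function.update (joinStk w u v S₁ S₂) .tmp₂ x = joinStk w u x S₁ S₂ := by
  funext k; cases k <;> rfl

@[simp] theorem update_left (k : K₁) (y : List (Γ₁ k)) :
    Function.update (joinStk w u v S₁ S₂) (.left k) y =
      joinStk w u v (Function.update S₁ k y) S₂ := by
  funext j
  cases j with
  | left j =>
    by_cases h : j = k
    · subst h; simp [joinStk]
    · simp [joinStk, h]
  | _ => rfl

@[simp] theorem update_right (k : K₂) (y : List (Γ₂ k)) :
    Function.update (joinStk w u v S₁ S₂) (.right k) y =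
      joinStk w u v S₁ (Function.update S₂ k y) := by
  funext j
  cases j with
  | right j =>
    by_cases h : j = k
    · subst h; simp [joinStk]
    · simp [joinStk, h]
  | _ => rfl

/-- Successive pushes store a word in reverse; moving the auxiliary stack later undoes the reversal.
-/
theorem stepAux_pushAll (q : TM2.Stmt (Alphabet Γ₁ Γ₂) (Label Q Λ₁ Λ₂) (State σ₁ σ₂))
    (s : State σ₁ σ₂) (a b : Str) :
    TM2.stepAux (pushAll a b q) s (joinStk w u v S₁ S₂) =
      TM2.stepAux q s (joinStk w (a.reverse ++ u) (b.reverse ++ v) S₁ S₂) := by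
  unfold pushAll
  induction a generalizing u with
  | nil =>
    induction b generalizing v with
    | nil => rfl
    | cons c b ih =>
      have := ih (c :: v)
      simp_all [joinStk]
  | cons c a ih =>
    have := ih (c :: u)
    simp_all [joinStk]

/-- A configuration of the first machine, as one of the combination. -/
def embedLeft (S₂ : ∀ k, List (Γ₂ k)) (r : σ₂ × Option Bool) (c : TM2.Cfg Γ₁ Λ₁ σ₁) :
    TM2.Cfg (Alphabet Γ₁ Γ₂) (Label Q Λ₁ Λ₂) (State σ₁ σ₂) :=
  ⟨some (c.l.elim .between .left), (c.var, r), joinStk [] [] [] c.stk S₂⟩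

/-- A configuration of the second machine, as one of the combination. -/
def embedRight (S₁ : ∀ k, List (Γ₁ k)) (s : σ₁) (r : Option Bool) (c : TM2.Cfg Γ₂ Λ₂ σ₂) :
    TM2.Cfg (Alphabet Γ₁ Γ₂) (Label Q Λ₁ Λ₂) (State σ₁ σ₂) :=
  ⟨some (c.l.elim .finish .right), (s, c.var, r), joinStk [] [] [] S₁ c.stk⟩

/-- A halt of the first machine becomes a jump to `between`, so its halted configurations embed as
running ones. -/
theorem stepAux_liftLeft (q : TM2.Stmt Γ₁ Λ₁ σ₁) (s : σ₁) (r : σ₂ × Option Bool) :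
    TM2.stepAux (liftLeft (Q := Q) (Λ₂ := Λ₂) (Γ₂ := Γ₂) q) (s, r) (joinStk [] [] [] S₁ S₂) =
      embedLeft S₂ r (TM2.stepAux q s S₁) := by
  induction q generalizing s S₁ with
  | push k f q ih => simp only [liftLeft, TM2.stepAux, update_left]; exact ih _ _
  | peek k f q ih => simp only [liftLeft, TM2.stepAux]; exact ih _ _
  | pop k f q ih => simp only [liftLeft, TM2.stepAux, update_left]; exact ih _ _
  | load f q ih => simp only [liftLeft, TM2.stepAux]; exact ih _ _
  | branch f q₁ q₂ ih₁ ih₂ =>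
    cases h : f s
    · simpa [liftLeft, h] using ih₂ _ _
    · simpa [liftLeft, h] using ih₁ _ _
  | goto f => rfl
  | halt => rfl

theorem stepAux_liftRight (q : TM2.Stmt Γ₂ Λ₂ σ₂) (s : σ₁) (s₂ : σ₂) (r : Option Bool) :
    TM2.stepAux (liftRight (Q := Q) (Λ₁ := Λ₁) (Γ₁ := Γ₁) q) (s, s₂, r)
      (joinStk [] [] [] S₁ S₂) = embedRight S₁ s r (TM2.stepAux q s₂ S₂) := by
  induction q generalizing s₂ S₂ with
  | push k f q ih => simp only [liftRight, TM2.stepAux, update_right]; exact ih _ _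
  | peek k f q ih => simp only [liftRight, TM2.stepAux]; exact ih _ _
  | pop k f q ih => simp only [liftRight, TM2.stepAux, update_right]; exact ih _ _
  | load f q ih => simp only [liftRight, TM2.stepAux]; exact ih _ _
  | branch f q₁ q₂ ih₁ ih₂ =>
    cases h : f s₂
    · simpa [liftRight, h] using ih₂ _ _
    · simpa [liftRight, h] using ih₁ _ _
  | goto f => rfl
  | halt => rfl

end Stmt

/-- Move an auxiliary stack to the stack `k`, then go to `l`. -/
def move {K₁ K₂ Q Λ₁ Λ₂ σ₁ σ₂ : Type} {Γ₁ : K₁ → Type} {Γ₂ : K₂ → Type}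
    (t k : Stack K₁ K₂) (ofBool : Bool → Alphabet Γ₁ Γ₂ k)
    (toBool : Alphabet Γ₁ Γ₂ t → Bool) (here l : Label Q Λ₁ Λ₂) :
    TM2.Stmt (Alphabet Γ₁ Γ₂) (Label Q Λ₁ Λ₂) (State σ₁ σ₂) :=
  .pop t (fun s a => (s.1, s.2.1, a.map toBool)) <|
    .branch (fun s => s.2.2.isSome)
      (.push k (fun s => ofBool (s.2.2.getD false)) (.goto fun _ => here))
      (.goto fun _ => l)

open scoped Classical in
/-- The program of a combination of two machines with the programs `m₁` and `m₂`. -/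
noncomputable def program (d : Bool) (T : Splitter) (M₁ M₂ : NTM)
    (m₁ : M₁.tm.Λ → TM2.Stmt M₁.tm.Γ M₁.tm.Λ M₁.tm.σ)
    (m₂ : M₂.tm.Λ → TM2.Stmt M₂.tm.Γ M₂.tm.Λ M₂.tm.σ) :
    Label T.Q M₁.tm.Λ M₂.tm.Λ → TM2.Stmt (Alphabet M₁.tm.Γ M₂.tm.Γ)
      (Label T.Q M₁.tm.Λ M₂.tm.Λ) (State M₁.tm.σ M₂.tm.σ)
  | .read q =>
    .pop .inp (fun s a => (s.1, s.2.1, a)) <|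
      .branch (fun s => s.2.2 = some true)
        (pushAll (T.out₁ q true) (T.out₂ q true) (.goto fun _ => .read (T.next q true))) <|
      .branch (fun s => s.2.2 = some false)
        (pushAll (T.out₁ q false) (T.out₂ q false) (.goto fun _ => .read (T.next q false))) <|
      match T.final q with
      | none => .halt
      | some p => pushAll p.1 p.2 (.goto fun _ => .move₁)
  | .move₁ => move .tmp₁ (.left M₁.tm.k₀) M₁.inputAlphabet.symm id .move₁ .move₂
  | .move₂ => move .tmp₂ (.right M₂.tm.k₀) M₂.inputAlphabet.symm id .move₂ (.left M₁.tm.main)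
  | .left l => liftLeft (m₁ l)
  | .between =>
    .branch (fun s => decide (s.1 ∈ M₁.accept) = d)
      (.load (fun s => (s.1, s.2.1, some d)) .halt) (.goto fun _ => .right M₂.tm.main)
  | .right l => liftRight (m₂ l)
  | .finish => .load (fun s => (s.1, s.2.1, some (decide (s.2.1 ∈ M₂.accept)))) .halt

end Combine

open Combine

/-- The combination of two machines: they are run on the two outputs of the splitter `T`. The
combination accepts if one of them accepts (for `d = true`), or if both accept (for `d = false`). -/
noncomputable def combine (d : Bool) (T : Splitter) (M₁ M₂ : NTM) : NTM where
  tm :=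
    { K := Stack M₁.tm.K M₂.tm.K
      kFin := by
        have := M₁.tm.kFin
        have := M₂.tm.kFin
        infer_instance
      k₀ := .inp
      k₁ := .inp
      Γ := Alphabet M₁.tm.Γ M₂.tm.Γ
      Λ := Label T.Q M₁.tm.Λ M₂.tm.Λ
      main := .read T.start
      ΛFin := by
        have := M₁.tm.ΛFin
        have := M₂.tm.ΛFin
        infer_instance
      σ := State M₁.tm.σ M₂.tm.σ
      initialState := (M₁.tm.initialState, M₂.tm.initialState, none)
      σFin := by
        have := M₁.tm.σFin
        have := M₂.tm.σFin
        infer_instance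
      Γk₀Fin := inferInstanceAs (Fintype Bool)
      m := program d T M₁ M₂ M₁.tm.m M₂.tm.m }
  alt := program d T M₁ M₂ M₁.alt M₂.alt
  inputAlphabet := Equiv.refl Bool
  accept := {s | s.2.2 = some true}

namespace Combine

variable {d : Bool} {T : Splitter} {M₁ M₂ : NTM}

theorem prog_combine (b : Bool) :
    (combine d T M₁ M₂).prog b = program d T M₁ M₂ (M₁.prog b) (M₂.prog b) := by
  cases b <;> rfl

theorem deterministic_combine (h₁ : M₁.Deterministic) (h₂ : M₂.Deterministic) :
    (combine d T M₁ M₂).Deterministic := by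
  unfold NTM.Deterministic at *
  change program d T M₁ M₂ M₁.alt M₂.alt = program d T M₁ M₂ M₁.tm.m M₂.tm.m
  rw [h₁, h₂]

/-- The type of the configurations of a combination. -/
abbrev CombCfg (T : Splitter) (M₁ M₂ : NTM) : Type :=
  TM2.Cfg (Alphabet M₁.tm.Γ M₂.tm.Γ) (Label T.Q M₁.tm.Λ M₂.tm.Λ) (State M₁.tm.σ M₂.tm.σ)

variable (s₁ : M₁.tm.σ) (s₂ : M₂.tm.σ) (r : Option Bool)
  (S₁ : ∀ k, List (M₁.tm.Γ k)) (S₂ : ∀ k, List (M₂.tm.Γ k))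

theorem step_combine (b : Bool) (l : Label T.Q M₁.tm.Λ M₂.tm.Λ) (s : State M₁.tm.σ M₂.tm.σ)
    (S : ∀ k, List (Alphabet M₁.tm.Γ M₂.tm.Γ k)) :
    TM2.step ((combine d T M₁ M₂).prog b) (⟨some l, s, S⟩ : CombCfg T M₁ M₂) =
      some (TM2.stepAux (program d T M₁ M₂ (M₁.prog b) (M₂.prog b) l) s S) := by
  rw [prog_combine]
  rfl

theorem leads_one (l : Label T.Q M₁.tm.Λ M₂.tm.Λ) (s : State M₁.tm.σ M₂.tm.σ)
    (S : ∀ k, List (Alphabet M₁.tm.Γ M₂.tm.Γ k)) (c : CombCfg T M₁ M₂)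
    (h : ∀ b, TM2.stepAux (program d T M₁ M₂ (M₁.prog b) (M₂.prog b) l) s S = c) :
    (combine d T M₁ M₂).Leads 1 (⟨some l, s, S⟩ : CombCfg T M₁ M₂) c :=
  NTM.Leads.of_step fun b => (step_combine b l s S).trans (congrArg some (h b))

theorem acc_combine_iff (s : State M₁.tm.σ M₂.tm.σ)
    (S : ∀ k, List (Alphabet M₁.tm.Γ M₂.tm.Γ k)) :
    (combine d T M₁ M₂).Acc (⟨none, s, S⟩ : CombCfg T M₁ M₂) ↔ s.2.2 = some true :=
  NTM.acc_iff_of_halted (N := combine d T M₁ M₂) rfl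

theorem leads_read_cons (q : T.Q) (a : Bool) (w u v : Str) :
    (combine d T M₁ M₂).Leads 1
      (⟨some (.read q), (s₁, s₂, r), joinStk (a :: w) u v S₁ S₂⟩ : CombCfg T M₁ M₂)
      (⟨some (.read (T.next q a)), (s₁, s₂, some a),
        joinStk w ((T.out₁ q a).reverse ++ u) ((T.out₂ q a).reverse ++ v) S₁ S₂⟩ :
          CombCfg T M₁ M₂) := by
  refine leads_one _ _ _ _ fun b => ?_
  cases a <;> simp [program, joinStk.eq_1, stepAux_pushAll]

theorem leads_read {q : T.Q} {w x y : Str} (h : T.runFrom q w = some (x, y)) (u v : Str) :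
    (combine d T M₁ M₂).Leads (w.length + 1)
      (⟨some (.read q), (s₁, s₂, r), joinStk w u v S₁ S₂⟩ : CombCfg T M₁ M₂)
      (⟨some .move₁, (s₁, s₂, none), joinStk [] (x.reverse ++ u) (y.reverse ++ v) S₁ S₂⟩ :
        CombCfg T M₁ M₂) := by
  induction w generalizing q r x y u v with
  | nil =>
    refine leads_one _ _ _ _ fun b => ?_
    replace h : T.final q = some (x, y) := h
    simp [program, joinStk.eq_1, stepAux_pushAll, h]
  | cons a w ih =>
    simp only [Splitter.runFrom, Option.map_eq_some_iff, Prod.mk.injEq] at h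
    obtain ⟨⟨x', y'⟩, h, rfl, rfl⟩ := h
    have := (leads_read_cons (d := d) s₁ s₂ r S₁ S₂ q a w u v).trans (ih (some a) h _ _)
    simp only [List.reverse_append, List.append_assoc]
    exact this.mono (by simp; omega)

/-- Rejection is recorded by the last component of the state, which is `none` after popping the
empty input stack; the stacks left behind are irrelevant. -/
theorem leads_read_none {q : T.Q} {w : Str} (h : T.runFrom q w = none) (u v : Str) :
    ∃ S, (combine d T M₁ M₂).Leads (w.length + 1)
      (⟨some (.read q), (s₁, s₂, r), joinStk w u v S₁ S₂⟩ : CombCfg T M₁ M₂)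
      (⟨none, (s₁, s₂, none), S⟩ : CombCfg T M₁ M₂) := by
  induction w generalizing q r u v with
  | nil =>
    refine ⟨joinStk [] u v S₁ S₂, leads_one _ _ _ _ fun b => ?_⟩
    replace h : T.final q = none := h
    simp [program, joinStk.eq_1, h]
  | cons a w ih =>
    simp only [Splitter.runFrom, Option.map_eq_none_iff] at h
    obtain ⟨S, hS⟩ := ih (some a) h ((T.out₁ q a).reverse ++ u) ((T.out₂ q a).reverse ++ v)
    exact ⟨S, ((leads_read_cons s₁ s₂ r S₁ S₂ q a w u v).trans hS).mono (by simp; omega)⟩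

theorem leads_move₁ (u v : Str) :
    (combine d T M₁ M₂).Leads (u.length + 1)
      (⟨some .move₁, (s₁, s₂, r), joinStk [] u v S₁ S₂⟩ : CombCfg T M₁ M₂)
      (⟨some .move₂, (s₁, s₂, none), joinStk [] [] v (Function.update S₁ M₁.tm.k₀
        ((u.map M₁.inputAlphabet.symm).reverse ++ S₁ M₁.tm.k₀)) S₂⟩ : CombCfg T M₁ M₂) := by
  induction u generalizing r S₁ with
  | nil =>
    refine leads_one _ _ _ _ fun b => ?_
    simp [program, move, joinStk.eq_2]
  | cons a u ih =>
    have h : (combine d T M₁ M₂).Leads 1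
        (⟨some .move₁, (s₁, s₂, r), joinStk [] (a :: u) v S₁ S₂⟩ : CombCfg T M₁ M₂)
        (⟨some .move₁, (s₁, s₂, some a), joinStk [] u v (Function.update S₁ M₁.tm.k₀
          (M₁.inputAlphabet.symm a :: S₁ M₁.tm.k₀)) S₂⟩ : CombCfg T M₁ M₂) :=
      leads_one _ _ _ _ fun b => by simp [program, move, joinStk.eq_2, joinStk.eq_4]
    simpa using (h.trans (ih _ _)).mono (n := (a :: u).length + 1) (by grind)

theorem leads_move₂ (v : Str) :
    (combine d T M₁ M₂).Leads (v.length + 1)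
      (⟨some .move₂, (s₁, s₂, r), joinStk [] [] v S₁ S₂⟩ : CombCfg T M₁ M₂)
      (⟨some (.left M₁.tm.main), (s₁, s₂, none), joinStk [] [] [] S₁ (Function.update S₂ M₂.tm.k₀
        ((v.map M₂.inputAlphabet.symm).reverse ++ S₂ M₂.tm.k₀))⟩ : CombCfg T M₁ M₂) := by
  induction v generalizing r S₂ with
  | nil =>
    refine leads_one _ _ _ _ fun b => ?_
    simp [program, move, joinStk.eq_3]
  | cons a v ih =>
    have h : (combine d T M₁ M₂).Leads 1
        (⟨some .move₂, (s₁, s₂, r), joinStk [] [] (a :: v) S₁ S₂⟩ : CombCfg T M₁ M₂)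
        (⟨some .move₂, (s₁, s₂, some a), joinStk [] [] v S₁ (Function.update S₂ M₂.tm.k₀
          (M₂.inputAlphabet.symm a :: S₂ M₂.tm.k₀))⟩ : CombCfg T M₁ M₂) :=
      leads_one _ _ _ _ fun b => by simp [program, move, joinStk.eq_3, joinStk.eq_5]
    simpa using (h.trans (ih _ _)).mono (n := (a :: v).length + 1) (by grind)

theorem init_combine (w : Str) :
    (combine d T M₁ M₂).init w = (⟨some (.read T.start),
      (M₁.tm.initialState, M₂.tm.initialState, none),
      joinStk w [] [] (fun _ => []) (fun _ => [])⟩ : CombCfg T M₁ M₂) := by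
  rw [NTM.init_eq]
  refine congrArg (TM2.Cfg.mk _ _) (funext fun k => ?_)
  cases k with
  | inp => exact (Function.update_self ..).trans w.map_id
  | _ => rfl

theorem leads_left {w x y : Str} (h : T.run w = some (x, y)) :
    (combine d T M₁ M₂).Leads (w.length + x.length + y.length + 3) ((combine d T M₁ M₂).init w)
      (embedLeft (M₂.init y).stk (M₂.tm.initialState, none) (M₁.init x) : CombCfg T M₁ M₂) := by
  rw [init_combine, NTM.init_eq x, NTM.init_eq y]
  have h₁ := leads_read (d := d) M₁.tm.initialState M₂.tm.initialState none (fun _ => [])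
    (fun _ => []) h [] []
  have h₂ := (h₁.trans (leads_move₁ ..)).trans (leads_move₂ ..)
  simp only [List.append_nil, List.map_reverse, List.reverse_reverse] at h₂
  exact h₂.mono (by simp; omega)

/-- The second machine, run as a part of the combination. -/
theorem halts_and_acc_right {y : Str} {t : ℕ} (h : M₂.HaltsWithin y t) :
    (combine d T M₁ M₂).Halts (t + 1)
        (embedRight S₁ s₁ r (M₂.init y) : CombCfg T M₁ M₂) ∧
      ((combine d T M₁ M₂).Acc (embedRight S₁ s₁ r (M₂.init y) : CombCfg T M₁ M₂) ↔
        M₂.Accepts y) := by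
  classical
  have hfin : ∀ c : M₂.tm.Cfg, c.l = none → (combine d T M₁ M₂).Leads 1
      (embedRight S₁ s₁ r c : CombCfg T M₁ M₂)
      (⟨none, (s₁, c.var, some (decide (c.var ∈ M₂.accept))), joinStk [] [] [] S₁ c.stk⟩ :
        CombCfg T M₁ M₂) := by
    rintro ⟨l, v, S⟩ hl
    obtain rfl : l = none := hl
    exact leads_one _ _ _ _ fun b => by simp [program]
  have key := NTM.halts_and_acc_of_simulation (N := combine d T M₁ M₂)
    (fun c => (embedRight S₁ s₁ r c : CombCfg T M₁ M₂))
    (fun l v S b => (step_combine b (.right l) _ _).trans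
      (congrArg some (stepAux_liftRight S₁ S (M₂.prog b l) s₁ v r))) h
  constructor
  · refine (key.1 1 fun c hc => ?_).mono (by omega)
    exact (hfin c hc.2).1 0 (NTM.halts_of_halted rfl)
  · rw [key.2, NTM.accepts_iff_acc]
    refine exists_congr fun c => and_congr_right fun hc => ?_
    exact ((hfin c hc.2).2.trans (acc_combine_iff ..)).trans (by simp)

/-- Evaluation is short-circuited: if the answer of `M₁` equals `d`, it settles the result;
otherwise the result is the answer of `M₂`. Since acceptance is existential, this is correct path by
path for both connectives; no complementation is involved. -/
theorem halts_and_accepts {w x y : Str} (h : T.run w = some (x, y)) {t₁ t₂ : ℕ}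
    (h₁ : M₁.HaltsWithin x t₁) (h₂ : M₂.HaltsWithin y t₂) :
    (combine d T M₁ M₂).HaltsWithin w (w.length + x.length + y.length + t₁ + t₂ + 5) ∧
      ((combine d T M₁ M₂).Accepts w ↔
        cond d (M₁.Accepts x ∨ M₂.Accepts y) (M₁.Accepts x ∧ M₂.Accepts y)) := by
  classical
  have hpre := leads_left (d := d) (M₁ := M₁) (M₂ := M₂) h
  have hearly : ∀ c : M₁.tm.Cfg, c.l = none → decide (c.var ∈ M₁.accept) = d →
      (combine d T M₁ M₂).Leads 1
      (embedLeft (M₂.init y).stk (M₂.tm.initialState, none) c : CombCfg T M₁ M₂)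
      (⟨none, (c.var, M₂.tm.initialState, some d), joinStk [] [] [] c.stk (M₂.init y).stk⟩ :
        CombCfg T M₁ M₂) := by
    rintro ⟨l, v, S⟩ hl hd
    obtain rfl : l = none := hl
    exact leads_one _ _ _ _ fun b => by simp [program, ← hd]
  have hgo : ∀ c : M₁.tm.Cfg, c.l = none → decide (c.var ∈ M₁.accept) ≠ d →
      (combine d T M₁ M₂).Leads 1
      (embedLeft (M₂.init y).stk (M₂.tm.initialState, none) c : CombCfg T M₁ M₂)
      (embedRight c.stk c.var none (M₂.init y) : CombCfg T M₁ M₂) := by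
    rintro ⟨l, v, S⟩ hl hd
    obtain rfl : l = none := hl
    exact leads_one _ _ _ _ fun b => by
      simp [program, show ¬ _ = _ from hd]
      rfl
  have key := NTM.halts_and_acc_of_simulation (N := combine d T M₁ M₂)
    (fun c => (embedLeft (M₂.init y).stk (M₂.tm.initialState, none) c : CombCfg T M₁ M₂))
    (fun l v S b => (step_combine b (.left l) _ _).trans
      (congrArg some (stepAux_liftLeft S _ (M₁.prog b l) v _))) h₁
  have hacc : ∀ c : M₁.tm.Cfg, c.l = none → ((combine d T M₁ M₂).Acc
      (embedLeft (M₂.init y).stk (M₂.tm.initialState, none) c : CombCfg T M₁ M₂) ↔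
      cond d (c.var ∈ M₁.accept ∨ M₂.Accepts y) (c.var ∈ M₁.accept ∧ M₂.Accepts y)) := by
    intro c hc
    by_cases hd : decide (c.var ∈ M₁.accept) = d
    · refine ((hearly c hc hd).2.trans (acc_combine_iff ..)).trans ?_
      cases d <;> simp_all
    · rw [(hgo c hc hd).2, (halts_and_acc_right (d := d) c.var none c.stk h₂).2]
      cases d <;> simp_all
  constructor
  -- Beyond `t₂`, one step is spent at `between` and one at `finish`.
  · refine NTM.Halts.mono (hpre.1 _ (key.1 (t₂ + 2) fun c hc => ?_)) (by omega)
    by_cases hd : decide (c.var ∈ M₁.accept) = d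
    · exact ((hearly c hc.2 hd).1 0 (NTM.halts_of_halted rfl)).mono (by omega)
    · exact (hgo c hc.2 hd).1 _ (halts_and_acc_right (d := d) c.var none c.stk h₂).1
  · rw [NTM.accepts_iff_acc, hpre.2, key.2, NTM.accepts_iff_acc (N := M₁)]
    have : (∃ c, M₁.Final (M₁.init x) c ∧ (combine d T M₁ M₂).Acc
        (embedLeft (M₂.init y).stk (M₂.tm.initialState, none) c : CombCfg T M₁ M₂)) ↔
        ∃ c, M₁.Final (M₁.init x) c ∧
          cond d (c.var ∈ M₁.accept ∨ M₂.Accepts y) (c.var ∈ M₁.accept ∧ M₂.Accepts y) :=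
      exists_congr fun c => and_congr_right fun hc => hacc c hc.2
    rw [this]
    -- `M₂` is reached only through a halting path of `M₁`, so such a path must exist for acceptance
    -- by `M₂` alone to count in a disjunction.
    obtain ⟨c, hc⟩ := NTM.exists_final (t := t₁) h₁
    cases d
    · simp [NTM.Acc, ← and_assoc]
    · simp only [NTM.Acc, cond_true]
      constructor
      · rintro ⟨c, hc, h | h⟩
        exacts [.inl ⟨c, hc, h⟩, .inr h]
      · rintro (⟨c, hc, h⟩ | h)
        exacts [⟨c, hc, .inl h⟩, ⟨c, hc, .inr h⟩]

theorem halts_and_not_accepts {w : Str} (h : T.run w = none) :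
    (combine d T M₁ M₂).HaltsWithin w (w.length + 1) ∧ ¬ (combine d T M₁ M₂).Accepts w := by
  obtain ⟨S, hS⟩ := leads_read_none (d := d) M₁.tm.initialState M₂.tm.initialState none
    (fun _ => []) (fun _ => []) h [] []
  rw [← init_combine] at hS
  constructor
  · exact (hS.1 0 (NTM.halts_of_halted rfl)).mono (by omega)
  · rw [NTM.accepts_iff_acc, hS.2.trans (acc_combine_iff ..)]
    simp

end Combine

/-! ### Closure of P and NP under combinations -/

theorem eval_mono (p : Polynomial ℕ) : Monotone fun n => p.eval n := by
  intro a b h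
  simp only [Polynomial.eval_eq_sum_range]
  exact Finset.sum_le_sum fun i _ => Nat.mul_le_mul_left _ (Nat.pow_le_pow_left h i)

/-- The outputs of `T` are linearly bounded in the input, so each time bound is composed with the
linear polynomial `s`; monotonicity of polynomials over `ℕ` justifies this. -/
theorem decides_combine {M₁ M₂ : NTM} {L₁ L₂ : Language Bool} (h₁ : M₁.DecidesInPolyTime L₁)
    (h₂ : M₂.DecidesInPolyTime L₂) (d : Bool) (T : Splitter) :
    (combine d T M₁ M₂).DecidesInPolyTime
      {w | ∃ x y, T.run w = some (x, y) ∧ cond d (x ∈ L₁ ∨ y ∈ L₂) (x ∈ L₁ ∧ y ∈ L₂)} := by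
  obtain ⟨⟨p₁, hp₁⟩, hL₁⟩ := h₁
  obtain ⟨⟨p₂, hp₂⟩, hL₂⟩ := h₂
  have hlen : ∀ {w x y}, T.run w = some (x, y) →
      x.length ≤ T.size * (w.length + 1) ∧ y.length ≤ T.size * (w.length + 1) :=
    T.length_runFrom
  constructor
  · let s : Polynomial ℕ := Polynomial.C T.size * (Polynomial.X + 1)
    refine ⟨Polynomial.X + s + s + p₁.comp s + p₂.comp s + 5, fun w => ?_⟩
    simp only [s, Polynomial.eval_add, Polynomial.eval_comp, Polynomial.eval_mul,
      Polynomial.eval_C, Polynomial.eval_X, Polynomial.eval_one, Polynomial.eval_ofNat]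
    cases h : T.run w with
    | none => exact NTM.Halts.mono (Combine.halts_and_not_accepts h).1 (by omega)
    | some p =>
      obtain ⟨x, y⟩ := p
      have := eval_mono p₁ (hlen h).1
      have := eval_mono p₂ (hlen h).2
      have := hlen h
      refine NTM.Halts.mono (Combine.halts_and_accepts h (hp₁ x) (hp₂ y)).1 ?_
      simp only at *
      omega
  · intro w
    change (∃ x y, T.run w = some (x, y) ∧ _) ↔ _
    cases h : T.run w with
    | none => simp [(Combine.halts_and_not_accepts h).2]
    | some p =>
      obtain ⟨x, y⟩ := p
      rw [(Combine.halts_and_accepts h (hp₁ x) (hp₂ y)).2, ← hL₁, ← hL₂]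
      constructor
      · rintro ⟨x', y', h', hc⟩
        obtain ⟨rfl, rfl⟩ := Prod.mk.inj (Option.some.inj h')
        exact hc
      · exact fun hc => ⟨x, y, rfl, hc⟩

theorem combine_mem_classNP {L₁ L₂ : Language Bool} (h₁ : L₁ ∈ classNP) (h₂ : L₂ ∈ classNP)
    (d : Bool) (T : Splitter) :
    {w | ∃ x y, T.run w = some (x, y) ∧ cond d (x ∈ L₁ ∨ y ∈ L₂) (x ∈ L₁ ∧ y ∈ L₂)} ∈ classNP :=
  h₁.elim fun _ h₁ => h₂.elim fun _ h₂ => ⟨_, decides_combine h₁ h₂ d T⟩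

theorem combine_mem_classP {L₁ L₂ : Language Bool} (h₁ : L₁ ∈ classP) (h₂ : L₂ ∈ classP)
    (d : Bool) (T : Splitter) :
    {w | ∃ x y, T.run w = some (x, y) ∧ cond d (x ∈ L₁ ∨ y ∈ L₂) (x ∈ L₁ ∧ y ∈ L₂)} ∈ classP :=
  h₁.elim fun _ h₁ => h₂.elim fun _ h₂ =>
    ⟨_, Combine.deterministic_combine h₁.1 h₂.1, decides_combine h₁.2 h₂.2 d T⟩

theorem classP_subset_classNP : classP ⊆ classNP := fun _ ⟨M, _, h⟩ => ⟨M, h⟩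

theorem double_cons (a : Bool) (x : Str) : double (a :: x) = a :: a :: double x := rfl

/-! ### Transducers for copying, pairing and unpairing -/

namespace Splitter

/-- Both outputs are a copy of the input. -/
def copy : Splitter where
  Q := Unit
  start := ()
  next _ _ := ()
  out₁ _ b := [b]
  out₂ _ b := [b]
  final _ := some ([], [])
  size := 1
  length_out₁ _ _ := le_rfl
  length_out₂ _ _ := le_rfl
  length_final := by simp

theorem run_copy (w : Str) : copy.run w = some (w, w) := by
  suffices ∀ q, copy.runFrom q w = some (w, w) from this _
  induction w with
  | nil => intro; rfl
  | cons b w ih => intro q; simp [runFrom, ih]; simp [copy]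

/-- Both outputs are the input, paired with the string `z`. -/
def pairWith (z : Str) : Splitter where
  Q := Unit
  start := ()
  next _ _ := ()
  out₁ _ b := [b, b]
  out₂ _ b := [b, b]
  final _ := some ([false, true] ++ double z, [false, true] ++ double z)
  size := (double z).length + 2
  length_out₁ _ _ := by simp
  length_out₂ _ _ := by simp
  length_final := by simp

theorem run_pairWith (z w : Str) : (pairWith z).run w = some (pair w z, pair w z) := by
  suffices ∀ q, (pairWith z).runFrom q w = some (pair w z, pair w z) from this _
  induction w with
  | nil => intro; rfl
  | cons b w ih => intro q; simp [runFrom, ih]; simp [pairWith, pair, double]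

/-- The states of the splitter that decodes a pair. -/
inductive UnpairState
  | first | firstHalf (b : Bool) | second | secondHalf (b : Bool) | dead
  deriving Fintype

/-- The two components of a pair. -/
def unpair : Splitter where
  Q := UnpairState
  start := .first
  next
    | .first, b => .firstHalf b
    | .firstHalf a, b => if a = b then .first else if b then .second else .dead
    | .second, b => .secondHalf b
    | .secondHalf a, b => if a = b then .second else .dead
    | .dead, _ => .dead
  out₁
    | .firstHalf a, b => if a = b then [a] else []
    | _, _ => []
  out₂
    | .secondHalf a, b => if a = b then [a] else []
    | _, _ => []
  final
    | .second => some ([], [])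
    | _ => none
  size := 1
  length_out₁ q b := by split <;> (try split) <;> simp
  length_out₂ q b := by split <;> (try split) <;> simp
  length_final q u v h := by
    split at h <;> simp_all

theorem runFrom_unpair_dead (w : Str) : unpair.runFrom UnpairState.dead w = none := by
  induction w with
  | nil => rfl
  | cons a w ih => simp only [runFrom, Option.map_eq_none_iff]; exact ih

theorem runFrom_unpair_first_eq (a : Bool) (w : Str) :
    unpair.runFrom UnpairState.first (a :: a :: w) =
      (unpair.runFrom UnpairState.first w).map fun p => (a :: p.1, p.2) := by
  simp [runFrom, unpair, Function.comp_def]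

theorem runFrom_unpair_second_eq (a : Bool) (w : Str) :
    unpair.runFrom UnpairState.second (a :: a :: w) =
      (unpair.runFrom UnpairState.second w).map fun p => (p.1, a :: p.2) := by
  simp [runFrom, unpair, Function.comp_def]

theorem runFrom_unpair_separator (w : Str) :
    unpair.runFrom UnpairState.first (false :: true :: w) =
      unpair.runFrom UnpairState.second w := by
  simp [runFrom, unpair]

theorem runFrom_unpair_double (y : Str) :
    unpair.runFrom UnpairState.second (double y) = some ([], y) := by
  induction y with
  | nil => rfl
  | cons a y ih => rw [double_cons, runFrom_unpair_second_eq, ih]; rfl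

/-- After the separator two unequal bits are fatal, so success forces a doubled word. -/
theorem eq_double_of_runFrom_unpair {w x y : Str}
    (h : unpair.runFrom UnpairState.second w = some (x, y)) : x = [] ∧ w = double y := by
  induction w using List.twoStepInduction generalizing x y with
  | nil => cases h; exact ⟨rfl, rfl⟩
  | singleton a => cases h
  | cons_cons a b w ih _ =>
    by_cases hab : a = b
    · subst hab
      rw [runFrom_unpair_second_eq] at h
      obtain ⟨⟨x', y'⟩, hw, h'⟩ := Option.map_eq_some_iff.1 h
      cases h'
      obtain ⟨rfl, rfl⟩ := ih hw
      exact ⟨rfl, rfl⟩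
    · have hd : unpair.runFrom UnpairState.second (a :: b :: w) = none := by
        simpa [runFrom, unpair, hab] using runFrom_unpair_dead w
      rw [hd] at h
      cases h

theorem run_unpair_pair (x y : Str) : unpair.run (pair x y) = some (x, y) := by
  change unpair.runFrom UnpairState.first _ = _
  induction x with
  | nil => exact (runFrom_unpair_separator _).trans (runFrom_unpair_double y)
  | cons a x ih =>
    change unpair.runFrom UnpairState.first (a :: a :: pair x y) = _
    rw [runFrom_unpair_first_eq, ih]
    rfl

theorem eq_pair_of_run_unpair {w x y : Str} (h : unpair.run w = some (x, y)) : w = pair x y := by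
  change unpair.runFrom UnpairState.first _ = _ at h
  induction w using List.twoStepInduction generalizing x y with
  | nil => cases h
  | singleton a => cases h
  | cons_cons a b w ih _ =>
    by_cases hab : a = b
    · subst hab
      rw [runFrom_unpair_first_eq] at h
      obtain ⟨⟨x', y'⟩, hw, h'⟩ := Option.map_eq_some_iff.1 h
      cases h'
      rw [ih hw]
      rfl
    · cases b with
      | true =>
        obtain rfl : a = false := by simpa using hab
        rw [runFrom_unpair_separator] at h
        obtain ⟨rfl, rfl⟩ := eq_double_of_runFrom_unpair h
        rfl
      | false =>
        have hd : unpair.runFrom UnpairState.first (a :: false :: w) = none := by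
          simpa [runFrom, unpair, hab] using runFrom_unpair_dead w
        rw [hd] at h
        cases h

theorem run_unpair_iff {w x y : Str} : unpair.run w = some (x, y) ↔ w = pair x y :=
  ⟨eq_pair_of_run_unpair, fun h => h ▸ run_unpair_pair x y⟩

end Splitter

/-! ### Closure properties used for the collapsed relations -/

theorem union_mem_classNP {L₁ L₂ : Language Bool} (h₁ : L₁ ∈ classNP) (h₂ : L₂ ∈ classNP) :
    {w | w ∈ L₁ ∨ w ∈ L₂} ∈ classNP := by
  simpa [Splitter.run_copy] using combine_mem_classNP h₁ h₂ true .copy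

theorem inter_mem_classP {L₁ L₂ : Language Bool} (h₁ : L₁ ∈ classP) (h₂ : L₂ ∈ classP) :
    {w | w ∈ L₁ ∧ w ∈ L₂} ∈ classP := by
  simpa [Splitter.run_copy] using combine_mem_classP h₁ h₂ false .copy

/-- Both outputs are the same pair and the same machine is run twice; the conjunction of a condition
with itself is the condition. -/
theorem pairWith_mem_classP {L : Language Bool} (h : L ∈ classP) (z : Str) :
    {w | pair w z ∈ L} ∈ classP := by
  simpa [Splitter.run_pairWith] using combine_mem_classP h h false (.pairWith z)

theorem pairs_mem_classNP {L : Language Bool} (h : L ∈ classNP) :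
    {w | ∃ x y, w = pair x y ∧ x ∈ L ∧ y ∈ L} ∈ classNP := by
  simpa [Splitter.run_unpair_iff] using combine_mem_classNP h h false .unpair

theorem pair_injective {x y x' y' : Str} (h : pair x y = pair x' y') : x = x' ∧ y = y' := by
  have := Splitter.run_unpair_pair x y
  rw [h, Splitter.run_unpair_pair] at this
  simpa [eq_comm] using this

/-! ### Deterministic machines with three stacks of bits -/

namespace ThreeStacks

/-- The indices of three stacks. -/
inductive Index
  | a | b | c
  deriving DecidableEq

instance : Fintype Index := ⟨{.a, .b, .c}, fun k => by cases k <;> simp⟩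

/-- Three stacks of bits. -/
def stk (u v w : Str) : Index → List Bool
  | .a => u
  | .b => v
  | .c => w

variable (u v w x : Str)

@[simp] theorem stk_a : stk u v w .a = u := rfl
@[simp] theorem stk_b : stk u v w .b = v := rfl
@[simp] theorem stk_c : stk u v w .c = w := rfl

@[simp] theorem update_a : Function.update (stk u v w) .a x = stk x v w := by
  funext k; cases k <;> rfl

@[simp] theorem update_b : Function.update (stk u v w) .b x = stk u x w := by
  funext k; cases k <;> rfl

@[simp] theorem update_c : Function.update (stk u v w) .c x = stk u v x := by
  funext k; cases k <;> rfl

variable {Λ σ : Type} [Fintype Λ] [Fintype σ]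

/-- A deterministic machine with three stacks of bits. -/
def machine (main : Λ) (start : σ) (m : Λ → TM2.Stmt (fun _ : Index => Bool) Λ σ)
    (accept : Set σ) : NTM where
  tm :=
    { K := Index
      k₀ := .a
      k₁ := .a
      Γ _ := Bool
      Λ := Λ
      main := main
      σ := σ
      initialState := start
      m := m }
  alt := m
  inputAlphabet := Equiv.refl Bool
  accept := accept

variable {main : Λ} {start : σ} {m : Λ → TM2.Stmt (fun _ : Index => Bool) Λ σ} {accept : Set σ}

/-- The type of the configurations of a machine with three stacks. -/
abbrev Cfg (Λ σ : Type) : Type := TM2.Cfg (fun _ : Index => Bool) Λ σ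

theorem init_machine : (machine main start m accept).init w =
    (⟨some main, start, stk w [] []⟩ : Cfg Λ σ) := by
  rw [NTM.init_eq]
  refine congrArg (TM2.Cfg.mk _ _) (funext fun k => ?_)
  cases k with
  | a => exact (Function.update_self ..).trans w.map_id
  | _ => rfl

theorem leads_of_stepAux {l : Λ} {s : σ} {S : Index → List Bool} {c : Cfg Λ σ}
    (h : TM2.stepAux (m l) s S = c) :
    (machine main start m accept).Leads 1 (⟨some l, s, S⟩ : Cfg Λ σ) c :=
  NTM.Leads.of_step fun b => by
    cases b <;> exact congrArg some h

/-- The machine halts within `t` steps from `c`, and it accepts if and only if `p` holds. -/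
def Decides (N : NTM) (t : ℕ) (c : N.tm.Cfg) (p : Prop) : Prop := N.Halts t c ∧ (N.Acc c ↔ p)

theorem decides_halted {s : σ} {S : Index → List Bool} :
    Decides (machine main start m accept) 0 (⟨none, s, S⟩ : Cfg Λ σ) (s ∈ accept) :=
  ⟨NTM.halts_of_halted rfl, NTM.acc_iff_of_halted (N := machine main start m accept) rfl⟩

theorem _root_.KernelReduction.NTM.Leads.decides {N : NTM} {n t k : ℕ} {c c' : N.tm.Cfg}
    {p q : Prop} (h : N.Leads n c c') (h' : Decides N t c' p) (hpq : p ↔ q) (hk : t + n ≤ k) :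
    Decides N k c q :=
  ⟨(h.1 t h'.1).mono hk, (h.2.trans h'.2).trans hpq⟩

end ThreeStacks

open ThreeStacks

/-! ### Equality of strings is in P -/

namespace Diagonal

/-- The labels of the machine that recognizes the pairs with two equal components. -/
inductive Label
  | read | reverse | compare
  deriving DecidableEq

instance : Fintype Label := ⟨{.read, .reverse, .compare}, fun l => by cases l <;> simp⟩

/-- The last bits that were popped from the stacks. -/
abbrev State : Type := Option Bool × Option Bool × Option Bool

/-- The program of the machine that recognizes the pairs with two equal components. -/
def program : Label → TM2.Stmt (fun _ : Index => Bool) Label State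
  | .read =>
    .pop .a (fun s x => (x, s.2)) <| .pop .a (fun s x => (s.1, x, s.2.2)) <|
    .branch (fun s => s.1.isSome && s.1 = s.2.1)
      (.push .b (fun s => s.1.getD false) <| .goto fun _ => .read) <|
    .branch (fun s => s.1 = some false && s.2.1 = some true) (.goto fun _ => .reverse)
      (.load (fun _ => (some true, none, none)) .halt)
  | .reverse =>
    .pop .b (fun s x => (x, s.2)) <|
    .branch (fun s => s.1.isSome)
      (.push .c (fun s => s.1.getD false) <| .goto fun _ => .reverse) (.goto fun _ => .compare)
  | .compare =>
    .pop .a (fun s x => (x, s.2)) <| .pop .a (fun s x => (s.1, x, s.2.2)) <|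
    .pop .c (fun s x => (s.1, s.2.1, x)) <|
    .branch (fun s => s = (none, none, none)) .halt <|
    .branch (fun s => s.1 = s.2.1 && s.2.1 = s.2.2) (.goto fun _ => .compare)
      (.load (fun _ => (some true, none, none)) .halt)

/-- The machine that recognizes the pairs with two equal components. -/
def diagonalMachine : NTM :=
  machine .read ((none, none, none) : State) program {(none, none, none)}

/-- Acceptance is the state in which all three pops fail at once, so both words must be exhausted
together; each rejecting branch loads a different state. -/
theorem decides_compare (s : State) (w v y : Str) :
    Decides diagonalMachine (w.length + 1)
      (⟨some .compare, s, stk w v y⟩ : Cfg Label State) (w = double y) := by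
  induction w using List.twoStepInduction generalizing s y with
  | nil =>
    cases y with
    | nil => exact (leads_of_stepAux rfl).decides decides_halted (by simp [double]) (by simp)
    | cons c y => exact (leads_of_stepAux rfl).decides decides_halted (by simp [double]) (by simp)
  | singleton a =>
    cases y with
    | nil => exact (leads_of_stepAux rfl).decides decides_halted (by simp [double]) (by simp)
    | cons c y => exact (leads_of_stepAux rfl).decides decides_halted (by simp [double]) (by simp)
  | cons_cons a b w ih _ =>
    cases y with
    | nil =>
      refine (leads_of_stepAux (c := ⟨none, (some true, none, none), stk w v []⟩) ?_).decides
        decides_halted (by simp [double]) (by simp)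
      simp [program]
    | cons c y =>
      by_cases h : a = b ∧ b = c
      · obtain ⟨rfl, rfl⟩ := h
        exact (leads_of_stepAux (by simp [program])).decides (ih (some a, some a, some a) y)
          (by simp [double_cons]) (by simp)
      · refine (leads_of_stepAux (c := ⟨none, (some true, none, none), stk w v y⟩) ?_).decides
          decides_halted ?_ (by simp)
        · have : (decide (a = b) && decide (b = c)) = false := by simpa using h
          simp [program, this]
        · simp only [Set.mem_singleton_iff, double_cons]
          grind

theorem leads_reverse (s : State) (w v y : Str) : ∃ s',
    diagonalMachine.Leads (v.length + 1) (⟨some .reverse, s, stk w v y⟩ : Cfg Label State)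
      (⟨some .compare, s', stk w [] (v.reverse ++ y)⟩ : Cfg Label State) := by
  induction v generalizing s y with
  | nil => exact ⟨(none, s.2), leads_of_stepAux (by simp [program])⟩
  | cons a v ih =>
    obtain ⟨s', hs⟩ := ih (some a, s.2) (a :: y)
    have h : diagonalMachine.Leads 1 (⟨some .reverse, s, stk w (a :: v) y⟩ : Cfg Label State)
        (⟨some .reverse, (some a, s.2), stk w v (a :: y)⟩ : Cfg Label State) :=
      leads_of_stepAux (by simp [program])
    exact ⟨s', by simpa using (h.trans hs).mono (n := (a :: v).length + 1) (by grind)⟩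

theorem reject_read {s : State} {w v : Str} {t : ℕ} {S : Index → List Bool} {p : Prop}
    (hp : ¬ p)
    (h : TM2.stepAux (program .read) s (stk w v []) = ⟨none, (some true, none, none), S⟩) :
    Decides diagonalMachine (t + 1) (⟨some .read, s, stk w v []⟩ : Cfg Label State) p :=
  (leads_of_stepAux h).decides decides_halted (by simp [hp]) (by omega)

/-- Loop invariant: `v` is the reversed part of the first component read so far, and `x` is the part
still to come. Reversing `v` onto the third stack restores its order for the comparison. -/
theorem decides_read (s : State) (w v : Str) :
    Decides diagonalMachine (2 * w.length + v.length + 3)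
      (⟨some .read, s, stk w v []⟩ : Cfg Label State)
      (∃ x, w = double x ++ false :: true :: double (v.reverse ++ x)) := by
  induction w using List.twoStepInduction generalizing s v with
  | nil =>
    refine reject_read ?_ rfl
    rintro ⟨_ | ⟨a, x⟩, h⟩ <;> simp [double] at h
  | singleton a =>
    refine reject_read ?_ (S := stk [] v []) (by simp [program])
    rintro ⟨_ | ⟨b, x⟩, h⟩ <;> simp [double] at h
  | cons_cons a b w ih _ =>
    by_cases hab : a = b
    · subst hab
      have h : diagonalMachine.Leads 1
          (⟨some .read, s, stk (a :: a :: w) v []⟩ : Cfg Label State)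
          (⟨some .read, (some a, some a, s.2.2), stk w (a :: v) []⟩ : Cfg Label State) :=
        leads_of_stepAux (by simp [program])
      refine h.decides (ih _ _) ?_ (by simp; omega)
      constructor
      · rintro ⟨x, rfl⟩
        exact ⟨a :: x, by simp [double_cons]⟩
      · rintro ⟨_ | ⟨c, x⟩, h⟩
        · simp only [double, List.flatMap_nil, List.nil_append, List.cons.injEq] at h
          grind
        · simp only [double_cons, List.cons_append, List.cons.injEq] at h
          obtain ⟨rfl, -, rfl⟩ := h
          exact ⟨x, by simp⟩
    · by_cases hsep : a = false ∧ b = true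
      · obtain ⟨rfl, rfl⟩ := hsep
        have h : diagonalMachine.Leads 1
            (⟨some .read, s, stk (false :: true :: w) v []⟩ : Cfg Label State)
            (⟨some .reverse, (some false, some true, s.2.2), stk w v []⟩ : Cfg Label State) :=
          leads_of_stepAux (by simp [program])
        obtain ⟨s', hs⟩ := leads_reverse (some false, some true, s.2.2) w v []
        refine (h.trans hs).decides (decides_compare s' _ _ _) ?_ (by simp; omega)
        constructor
        · rintro rfl
          exact ⟨[], by simp [double]⟩
        · rintro ⟨_ | ⟨c, x⟩, h⟩
          · simpa [double] using h
          · simp only [double_cons, List.cons_append, List.cons.injEq] at h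
            grind
      · refine reject_read ?_ (S := stk w v []) (by simp [program, hab]; grind)
        rintro ⟨_ | ⟨c, x⟩, h⟩
        · simp [double] at h
          grind
        · simp only [double_cons, List.cons_append, List.cons.injEq] at h
          grind

end Diagonal

theorem diagonal_mem_classP : {w | ∃ x, w = pair x x} ∈ classP := by
  have key : ∀ w : Str, _ := fun w => Diagonal.decides_read (none, none, none) w []
  refine ⟨Diagonal.diagonalMachine, rfl, ⟨2 * .X + 3, fun w => ?_⟩, fun w => ?_⟩
  · have := (key w).1.mono (t := 2 * w.length + 3) (by simp)
    rw [← init_machine] at this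
    simpa using show Diagonal.diagonalMachine.HaltsWithin w _ from this
  · rw [NTM.accepts_iff_acc]
    refine Iff.trans ?_ (((key w).2.symm).trans (by rw [← init_machine]; rfl))
    change (∃ x, w = pair x x) ↔ _
    simp [pair]

/-! ### The parity of the iterated logarithm is in P -/

/-- The parity of the number of iterations of `Nat.log 2` that lead from `n` to `0`, minus one. -/
def logParity (n : ℕ) : Bool :=
  if h : Nat.log 2 n = 0 then false
  else
    have : Nat.log 2 n < n := Nat.log_lt_self 2 (by rintro rfl; simp at h)
    !logParity (Nat.log 2 n)

theorem logParity_of_log_eq_zero {n : ℕ} (h : Nat.log 2 n = 0) : logParity n = false := by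
  rw [logParity, dif_pos h]

theorem logParity_of_log_ne_zero {n : ℕ} (h : Nat.log 2 n ≠ 0) :
    logParity n = !logParity (Nat.log 2 n) := by
  rw [logParity, dif_neg h]

namespace LogParity

/-- The labels of the machine that computes `logParity` of the length of its input. -/
inductive Label
  | halve | check | copyBack | next | restart
  deriving DecidableEq

instance : Fintype Label :=
  ⟨{.halve, .check, .copyBack, .next, .restart}, fun l => by cases l <;> simp⟩

/-- The last two bits that were popped from a stack, and the current parity. -/
abbrev State : Type := Option Bool × Option Bool × Bool

/-- Forget what was popped, and go to `l`. -/
def jump (l : Label) : TM2.Stmt (fun _ : Index => Bool) Label State :=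
  .load (fun s => (none, none, s.2.2)) (.goto fun _ => l)

/-- The program of the machine that computes `logParity` of the length of its input. The logarithm
is computed on the stack `c`, by halving the length of the stack `a` repeatedly. -/
def program : Label → TM2.Stmt (fun _ : Index => Bool) Label State
  | .halve =>
    .pop .a (fun s x => (x, s.2)) <| .pop .a (fun s x => (s.1, x, s.2.2)) <|
    .branch (fun s => s.2.1.isSome) (.push .b (fun _ => true) (jump .halve)) (jump .check)
  | .check =>
    .pop .b (fun s x => (x, s.2)) <|
    .branch (fun s => s.1.isSome)
      (.push .a (fun _ => true) <| .push .c (fun _ => true) (jump .copyBack)) (jump .next)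
  | .copyBack =>
    .pop .b (fun s x => (x, s.2)) <|
    .branch (fun s => s.1.isSome) (.push .a (fun _ => true) (jump .copyBack)) (jump .halve)
  | .next =>
    .pop .c (fun s x => (x, s.2)) <|
    .branch (fun s => s.1.isSome)
      (.push .a (fun _ => true) <| .load (fun s => (s.1, s.2.1, !s.2.2)) (jump .restart)) .halt
  | .restart =>
    .pop .c (fun s x => (x, s.2)) <|
    .branch (fun s => s.1.isSome) (.push .a (fun _ => true) (jump .restart)) (jump .halve)

/-- The machine that decides whether `logParity` of the length of its input is `b`. -/
def parityMachine (b : Bool) : NTM :=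
  machine .halve ((none, none, false) : State) program {s | s.2.2 = b}

/-- A configuration of the machine. -/
def cfg (l : Label) (p : Bool) (u : Str) (m k : ℕ) : Cfg Label State :=
  ⟨some l, (none, none, p), stk u (.replicate m true) (.replicate k true)⟩

variable {b : Bool} (p : Bool) (u : Str) (m k : ℕ)

theorem leads_halve : (parityMachine b).Leads (u.length / 2 + 1) (cfg .halve p u m k)
    (cfg .check p [] (m + u.length / 2) k) := by
  induction u using List.twoStepInduction generalizing m with
  | nil => exact leads_of_stepAux (by simp [program, jump, cfg])
  | singleton a =>
    have h : (parityMachine b).Leads 1 (cfg .halve p [a] m k) (cfg .check p [] m k) :=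
      leads_of_stepAux (by simp [program, jump, cfg])
    have e : [a].length / 2 = 0 := by simp
    rwa [e]
  | cons_cons x y u ih _ =>
    have h : (parityMachine b).Leads 1 (cfg .halve p (x :: y :: u) m k)
        (cfg .halve p u (m + 1) k) :=
      leads_of_stepAux (by simp [program, jump, cfg, List.replicate_succ])
    have e : (x :: y :: u).length / 2 = u.length / 2 + 1 := by
      simp only [List.length_cons]; omega
    rw [e, add_comm (_ / 2), ← add_assoc m]
    exact (h.trans (ih (m + 1))).mono (by omega)

theorem leads_copyBack : (parityMachine b).Leads (m + 1) (cfg .copyBack p u m k)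
    (cfg .halve p (.replicate m true ++ u) 0 k) := by
  induction m generalizing u with
  | zero => exact leads_of_stepAux (by simp [program, jump, cfg])
  | succ m ih =>
    have h : (parityMachine b).Leads 1 (cfg .copyBack p u (m + 1) k)
        (cfg .copyBack p (true :: u) m k) :=
      leads_of_stepAux (by simp [program, jump, cfg, List.replicate_succ])
    have e : List.replicate (m + 1) true ++ u = List.replicate m true ++ true :: u := by
      simp [List.replicate_succ']
    rw [e]
    exact (h.trans (ih _)).mono (by omega)

theorem leads_restart : (parityMachine b).Leads (k + 1) (cfg .restart p u 0 k)
    (cfg .halve p (.replicate k true ++ u) 0 0) := by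
  induction k generalizing u with
  | zero => exact leads_of_stepAux (by simp [program, jump, cfg])
  | succ k ih =>
    have h : (parityMachine b).Leads 1 (cfg .restart p u 0 (k + 1))
        (cfg .restart p (true :: u) 0 k) :=
      leads_of_stepAux (by simp [program, jump, cfg, List.replicate_succ])
    have e : List.replicate (k + 1) true ++ u = List.replicate k true ++ true :: u := by
      simp [List.replicate_succ']
    rw [e]
    exact (h.trans (ih _)).mono (by omega)

/-- Each halving with nonzero result adds one mark to stack `c`. Halving shrinks the length
geometrically, so the total time is linear. -/
theorem leads_log : (parityMachine b).Leads (4 * u.length + 4) (cfg .halve p u 0 k)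
    (cfg .next p [] 0 (k + Nat.log 2 u.length)) := by
  induction h : u.length using Nat.strong_induction_on generalizing u k with
  | _ n ih =>
    have h₁ := leads_halve (b := b) p u 0 k
    rw [h, zero_add] at h₁
    by_cases hn : n < 2
    · have h₂ : (parityMachine b).Leads 1 (cfg .check p [] (n / 2) k) (cfg .next p [] 0 k) := by
        rw [Nat.div_eq_of_lt hn]
        exact leads_of_stepAux (by simp [program, jump, cfg])
      rw [Nat.log_of_lt hn, add_zero]
      exact (h₁.trans h₂).mono (by omega)
    · obtain ⟨j, hj⟩ : ∃ j, n / 2 = j + 1 := ⟨n / 2 - 1, by omega⟩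
      rw [hj] at h₁
      -- The bit popped to test that the half is nonzero goes back to `a`, and a mark is added to
      -- `c`.
      have h₂ : (parityMachine b).Leads 1 (cfg .check p [] (j + 1) k)
          (cfg .copyBack p [true] j (k + 1)) :=
        leads_of_stepAux (by simp [program, jump, cfg, List.replicate_succ])
      have h₃ := leads_copyBack (b := b) p [true] j (k + 1)
      have h₄ := ih (n / 2) (by omega) (List.replicate j true ++ [true]) (k + 1) (by simp [hj])
      rw [Nat.log_of_one_lt_of_le (by norm_num) (by omega), add_comm (Nat.log 2 _), ← add_assoc]
      exact (((h₁.trans h₂).trans h₃).trans h₄).mono (by omega)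

theorem two_mul_log_le {n : ℕ} (h : n ≠ 0) : 2 * Nat.log 2 n ≤ n := by
  refine le_trans ?_ (Nat.pow_log_le_self 2 h)
  cases Nat.log 2 n with
  | zero => simp
  | succ j =>
    have := j.lt_two_pow_self
    rw [pow_succ]
    omega

theorem decides_halve : Decides (parityMachine b) (20 * u.length + 20) (cfg .halve p u 0 0)
    ((p ^^ logParity u.length) = b) := by
  induction h : u.length using Nat.strong_induction_on generalizing u p with
  | _ n ih =>
    have h₁ := leads_log (b := b) p u 0
    rw [h, zero_add] at h₁
    cases hl : Nat.log 2 n with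
    | zero =>
      rw [hl] at h₁
      have h₂ : (parityMachine b).Leads 1 (cfg .next p [] 0 0)
          (⟨none, (none, none, p), stk [] [] []⟩ : Cfg Label State) :=
        leads_of_stepAux (by simp [program])
      exact (h₁.trans h₂).decides decides_halted
        (by simp [logParity_of_log_eq_zero hl]) (by omega)
    | succ j =>
      have hn : n ≠ 0 := by rintro rfl; simp at hl
      -- The next round works on at most half the length, so the linear bound survives the
      -- recursion.
      have hlog := two_mul_log_le hn
      rw [hl] at h₁ hlog
      have h₂ : (parityMachine b).Leads 1 (cfg .next p [] 0 (j + 1))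
          (cfg .restart (!p) [true] 0 j) :=
        leads_of_stepAux (by simp [program, jump, cfg, List.replicate_succ])
      have h₃ := leads_restart (b := b) (!p) [true] j
      have h₄ := ih (j + 1) (by omega) (!p) (List.replicate j true ++ [true]) (by simp)
      exact ((h₁.trans h₂).trans h₃).decides h₄
        (by simp [logParity_of_log_ne_zero (n := n) (by omega), hl]) (by omega)

end LogParity

theorem logParity_mem_classP (b : Bool) : {w : Str | logParity w.length = b} ∈ classP := by
  have key : ∀ w : Str, _ := fun w => LogParity.decides_halve (b := b) false w
  have hinit : ∀ w : Str, (LogParity.parityMachine b).init w = LogParity.cfg .halve false w 0 0 :=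
    fun w => init_machine w
  refine ⟨LogParity.parityMachine b, rfl, ⟨20 * .X + 20, fun w => ?_⟩, fun w => ?_⟩
  · have := (key w).1
    rw [← hinit] at this
    simpa using show (LogParity.parityMachine b).HaltsWithin w _ from this
  · rw [NTM.accepts_iff_acc, hinit]
    refine Iff.trans ?_ (key w).2.symm
    change logParity w.length = b ↔ _
    simp

/-! ### Polynomial bounds for the output length of functions in FP -/

section OutputLength

/-- The maximal number of symbols that a statement pushes. -/
def pushCount {K Λ σ : Type} {Γ : K → Type} : TM2.Stmt Γ Λ σ → ℕ
  | .push _ _ q => pushCount q + 1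
  | .peek _ _ q => pushCount q
  | .pop _ _ q => pushCount q
  | .load _ q => pushCount q
  | .branch _ q₁ q₂ => pushCount q₁ + pushCount q₂
  | .goto _ => 0
  | .halt => 0

/-- At a branch `pushCount` adds both alternatives; this overestimates but is enough for a bound. -/
theorem length_stepAux_le {K Λ σ : Type} [DecidableEq K] {Γ : K → Type} (q : TM2.Stmt Γ Λ σ)
    (v : σ) (S : ∀ k, List (Γ k)) (k : K) :
    ((TM2.stepAux q v S).stk k).length ≤ (S k).length + pushCount q := by
  induction q generalizing v S with
  | push j f q ih =>
    refine (ih _ _).trans ?_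
    by_cases h : k = j
    · subst h; simp [pushCount]; omega
    · simp [pushCount, h]
  | peek j f q ih => exact ih _ _
  | pop j f q ih =>
    refine (ih _ _).trans ?_
    by_cases h : k = j
    · subst h; simp [pushCount]
    · simp [pushCount, h]
  | load f q ih => exact ih _ _
  | branch f q₁ q₂ ih₁ ih₂ =>
    simp only [pushCount, TM2.stepAux]
    cases f v
    · exact (ih₂ _ _).trans (by omega)
    · exact (ih₁ _ _).trans (by omega)
  | goto f => simp [pushCount]
  | halt => simp [pushCount]

theorem exists_pushCount_le (M : FinTM2) : ∃ B, ∀ l, pushCount (M.m l) ≤ B := by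
  have := M.ΛFin
  exact ⟨Finset.univ.sup fun l => pushCount (M.m l), fun l =>
    Finset.le_sup (f := fun l => pushCount (M.m l)) (Finset.mem_univ l)⟩

theorem length_iterate_le (M : FinTM2) {B : ℕ} (hB : ∀ l, pushCount (M.m l) ≤ B) (k : M.K)
    (n : ℕ) {c d : M.Cfg} (h : (flip bind M.step)^[n] (some c) = some d) :
    (d.stk k).length ≤ (c.stk k).length + n * B := by
  induction n generalizing d with
  | zero =>
    cases h
    simp
  | succ n ih =>
    rw [Function.iterate_succ_apply'] at h
    obtain ⟨e, he, hd⟩ := Option.bind_eq_some_iff.1 h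
    have h₁ := ih he
    obtain ⟨l, v, S⟩ := e
    cases l with
    | none => cases hd
    | some l =>
      cases hd
      have h₂ := length_stepAux_le (M.m l) v S k
      have h₃ := hB l
      rw [add_mul, one_mul]
      simp only at h₁
      omega

theorem length_initList_le (M : FinTM2) (s : List (M.Γ M.k₀)) (k : M.K) :
    ((initList M s).stk k).length ≤ s.length := by
  unfold initList
  by_cases h : k = M.k₀
  · subst h; simp
  · simp [h]

/-- One step lengthens a stack by at most a constant `B`, as there are finitely many labels. The
term `X` is needed because the output stack may also be the input stack. -/
theorem exists_polynomial_length_le {f : Str → Str} (hf : f ∈ classFP) :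
    ∃ q : Polynomial ℕ, ∀ x, (f x).length ≤ q.eval x.length := by
  obtain ⟨M⟩ := hf
  obtain ⟨B, hB⟩ := exists_pushCount_le M.tm
  refine ⟨.X + M.time * .C B, fun x => ?_⟩
  have h := M.outputsFun x
  have hlen := length_iterate_le M.tm hB M.tm.k₁ h.steps h.evals_in_steps
  have hout : ((haltList M.tm ((f x).map M.outputAlphabet.invFun)).stk M.tm.k₁).length =
      (f x).length := by
    simp [haltList]
  have hinp : ((initList M.tm (x.map M.inputAlphabet.invFun)).stk M.tm.k₁).length ≤
      x.length := by
    simpa using length_initList_le M.tm (x.map M.inputAlphabet.invFun) M.tm.k₁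
  have hsteps := Nat.mul_le_mul_right B h.steps_le_m
  simp only [Polynomial.eval_add, Polynomial.eval_mul, Polynomial.eval_X, Polynomial.eval_C]
  simp only [id] at *
  omega

end OutputLength

/-! ### Length gaps and the counting argument -/

/-- The tower of powers of two. -/
def tower : ℕ → ℕ
  | 0 => 2
  | i + 1 => 2 ^ tower i

theorem lt_tower (i : ℕ) : i < tower i := by
  induction i with
  | zero => simp [tower]
  | succ i ih => exact (Nat.succ_le_of_lt ih).trans_lt Nat.lt_two_pow_self

/-- `Nat.log 2` maps each tower interval into the preceding one, and every application flips the
parity. -/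
theorem logParity_eq {i n : ℕ} (h₁ : tower i ≤ n) (h₂ : n < tower (i + 1)) :
    logParity n = !i.bodd := by
  induction i generalizing n with
  | zero =>
    replace h₁ : 2 ≤ n := h₁
    have h : Nat.log 2 n = 1 := by
      rw [Nat.log_eq_iff (by simp)]
      exact ⟨by simpa using h₁, by simpa [tower] using h₂⟩
    rw [logParity_of_log_ne_zero (by omega), h, logParity_of_log_eq_zero (by simp)]
    rfl
  | succ i ih =>
    have hn : n ≠ 0 := by
      have := lt_tower (i + 1)
      omega
    have h₃ : tower i ≤ Nat.log 2 n := Nat.le_log_of_pow_le (by norm_num) h₁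
    have h₄ : Nat.log 2 n < tower (i + 1) := Nat.log_lt_of_lt_pow hn h₂
    have := lt_tower i
    rw [logParity_of_log_ne_zero (by omega), ih h₃ h₄, Nat.bodd_succ]

theorem eventually_eval_lt_two_pow (q : Polynomial ℕ) :
    ∃ N, ∀ n, N ≤ n → q.eval (n + 1) < 2 ^ n := by
  have hle : ∀ n, q.eval (n + 1) ≤ q.eval 1 * (n + 1) ^ q.natDegree := by
    intro n
    simp only [Polynomial.eval_eq_sum_range, one_pow, mul_one, Finset.sum_mul]
    refine Finset.sum_le_sum fun i hi => Nat.mul_le_mul_left _ ?_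
    exact Nat.pow_le_pow_right (by omega) (by simpa [Nat.lt_succ_iff] using hi)
  have hlim := (tendsto_pow_const_div_const_pow_of_one_lt q.natDegree (r := 2) (by norm_num)).comp
    (Filter.tendsto_add_atTop_nat 1)
  -- The sum of coefficients `q.eval 1` is the constant in `hle`; adding 1 keeps the denominator
  -- positive, and the factor 2 absorbs the shift from `2 ^ (n + 1)` to `2 ^ n`.
  have hpos : (0 : ℝ) < 1 / (2 * (q.eval 1 + 1 : ℕ)) := by positivity
  obtain ⟨N, hN⟩ := Filter.eventually_atTop.1 (hlim.eventually (gt_mem_nhds hpos))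
  refine ⟨N, fun n hn => (hle n).trans_lt ?_⟩
  have h := hN n hn
  simp only [Function.comp_apply] at h
  rw [div_lt_div_iff₀ (by positivity) (by positivity), pow_succ, one_mul] at h
  have h' : (n + 1) ^ q.natDegree * (2 * (q.eval 1 + 1)) < 2 ^ n * 2 := by exact_mod_cast h
  nlinarith [Nat.zero_le ((n + 1) ^ q.natDegree)]

/-- The strings in `C` form one class, and all the others are only equivalent to themselves. -/
def collapse (C : Set Str) : Setoid Str where
  r x y := x = y ∨ x ∈ C ∧ y ∈ C
  iseqv := ⟨fun _ => .inl rfl, by grind, by grind⟩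

theorem card_strings_lt (m : ℕ) : Fintype.card (Σ k : Fin m, List.Vector Bool k) < 2 ^ m := by
  simp only [Fintype.card_sigma, card_vector, Fintype.card_bool]
  rw [Fin.sum_univ_eq_sum_range (fun k => 2 ^ k) m]
  exact Nat.geomSum_lt (by norm_num) (by simp)

/-- Equality does not reduce to a relation that collapses all the strings whose lengths have the
parity `b`, since that relation has few classes of short strings. -/
theorem not_polyKernelReduces_collapse {C : Set Str} {b : Bool}
    (hC : ∀ w : Str, logParity w.length = b → w ∈ C) : ¬ PolyKernelReduces ⊥ (collapse C) := by
  rintro ⟨f, hf, hred⟩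
  obtain ⟨q, hq⟩ := exists_polynomial_length_le hf
  obtain ⟨N, hN⟩ := eventually_eval_lt_two_pow q
  -- The parity of `i` is chosen so that all lengths between `tower i` and `tower (i + 1)` belong to
  -- the collapsed gap.
  obtain ⟨i, hi, hb⟩ : ∃ i, N ≤ i ∧ (!i.bodd) = b := by
    by_cases h : (!N.bodd) = b
    · exact ⟨N, le_rfl, h⟩
    · exact ⟨N + 1, by omega, by simpa [Nat.bodd_succ, Bool.eq_not] using h⟩
  set m := tower i
  have hmN : N ≤ m := hi.trans (lt_tower i).le
  have hlen : ∀ x : List.Vector Bool (m + 1), (f x.1).length < tower (i + 1) := fun x =>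
    (hq x.1).trans_lt (by rw [x.2]; exact hN m hmN)
  -- Short images are remembered exactly; `none` stands for the single class of all long ones.
  -- Length `m + 1` rather than `m` matters: there may be up to `2 ^ m` values, so `2 ^ m` inputs
  -- would give no contradiction.
  let g : List.Vector Bool (m + 1) → Option (Σ k : Fin m, List.Vector Bool k) := fun x =>
    if h : (f x.1).length < m then some ⟨⟨_, h⟩, ⟨f x.1, rfl⟩⟩ else none
  have hg : Function.Injective g := by
    intro x y hxy
    refine Subtype.ext ((hred x.1 y.1).2 ?_)
    by_cases hx : (f x.1).length < m <;> by_cases hy : (f y.1).length < m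
    · have := congrArg (Option.map fun p => p.2.1) hxy
      simp only [g, hx, hy, dite_true, Option.map_some, Option.some.injEq] at this
      exact .inl this
    · simp [g, hx, hy] at hxy
    · simp [g, hx, hy] at hxy
    · exact .inr ⟨hC _ ((logParity_eq (not_lt.1 hx) (hlen x)).trans hb),
        hC _ ((logParity_eq (not_lt.1 hy) (hlen y)).trans hb)⟩
  have hcard := Fintype.card_le_of_injective g hg
  have := card_strings_lt m
  rw [Fintype.card_option, card_vector, Fintype.card_bool, pow_succ] at hcard
  omega

/-! ### Complexity of equality and of the collapsed relations -/

theorem PEq_subset_NPEq : PEq ⊆ NPEq := fun _ h => classP_subset_classNP h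

theorem langOf_bot : langOf ⊥ = {w | ∃ x, w = pair x x} := by
  ext w
  constructor
  · rintro ⟨x, y, h, rfl⟩
    obtain rfl : x = y := h
    exact ⟨x, rfl⟩
  · rintro ⟨x, rfl⟩
    exact ⟨x, x, rfl, rfl⟩

theorem bot_mem_PEq : ⊥ ∈ PEq := by
  change langOf ⊥ ∈ classP
  rw [langOf_bot]
  exact diagonal_mem_classP

theorem collapse_mem_NPEq {C : Language Bool} (hC : C ∈ classNP) : collapse C ∈ NPEq := by
  have h := union_mem_classNP (classP_subset_classNP diagonal_mem_classP) (pairs_mem_classNP hC)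
  refine (congrArg (· ∈ classNP) (Set.ext fun w => ?_)).mp h
  constructor
  · rintro (⟨x, rfl⟩ | ⟨x, y, rfl, hx, hy⟩)
    · exact ⟨x, x, .inl rfl, rfl⟩
    · exact ⟨x, y, .inr ⟨hx, hy⟩, rfl⟩
  · rintro ⟨x, y, rfl | ⟨hx, hy⟩, rfl⟩
    · exact .inl ⟨x, rfl⟩
    · exact .inr ⟨x, y, rfl, hx, hy⟩

/-- With `z` in `C`, a string is equivalent to `z` exactly when it is in `C`; thus `w ↦ pair w z`
turns membership into equivalence. -/
theorem mem_classP_of_collapse_mem_PEq {C : Language Bool} {z : Str} (hz : z ∈ C)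
    (h : collapse C ∈ PEq) : C ∈ classP := by
  refine (congrArg (· ∈ classP) (Set.ext fun w => ?_)).mp (pairWith_mem_classP h z)
  constructor
  · rintro ⟨x, y, hxy, he⟩
    obtain ⟨rfl, rfl⟩ := pair_injective he
    rcases hxy with rfl | ⟨hw, -⟩
    exacts [hz, hw]
  · exact fun hw => ⟨w, z, .inr ⟨hw, hz⟩, rfl⟩

/-- Supplies a member of the big class for either parity, even if `langOf S` contributes none. -/
theorem exists_logParity_eq (b : Bool) : ∃ z : Str, logParity z.length = b := by
  cases b with
  | false => exact ⟨[], logParity_of_log_eq_zero (by simp)⟩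
  | true => exact ⟨[true, true], logParity_eq (i := 0) (by simp [tower]) (by simp [tower])⟩

end KernelReduction

open KernelReduction in
theorem mainTheorem4 (h : KernelReduction.PEq ≠ KernelReduction.NPEq) :
    ∃ R : Setoid KernelReduction.Str,
      R ∈ KernelReduction.NPEq ∧ R ∉ KernelReduction.PEq ∧
        ¬ KernelReduction.IsComplete KernelReduction.NPEq R := by
  obtain ⟨S, hS, hSP⟩ := Set.exists_of_ssubset (PEq_subset_NPEq.ssubset_of_ne h)
  let C : Bool → Language Bool := fun b => {w | logParity w.length = b ∨ w ∈ langOf S}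
  have hC : ∀ b, collapse (C b) ∈ NPEq := fun b =>
    collapse_mem_NPEq (union_mem_classNP (classP_subset_classNP (logParity_mem_classP b)) hS)
  obtain ⟨b, hb⟩ : ∃ b, collapse (C b) ∉ PEq := by
    by_contra! hP
    have hCP : ∀ b, C b ∈ classP := fun b =>
      (exists_logParity_eq b).elim fun z hz => mem_classP_of_collapse_mem_PEq (.inl hz) (hP b)
    refine hSP ((congrArg (· ∈ classP) (Set.ext fun w => ?_)).mp
      (inter_mem_classP (hCP true) (hCP false)))
    change (logParity w.length = true ∨ w ∈ langOf S) ∧ (logParity w.length = false ∨ _) ↔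
      w ∈ langOf S
    -- Every length has exactly one parity, so one of the two conditions reduces to membership in
    -- `langOf S`.
    cases logParity w.length <;> simp
  exact ⟨collapse (C b), hC b, hb, fun hcomplete =>
    not_polyKernelReduces_collapse (fun w hw => .inl hw)
      (hcomplete.2 ⊥ (PEq_subset_NPEq bot_mem_PEq))⟩
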